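/- Let $(\mathcal C,\otimes,\mathbb 1)$ be a monoidal category (coherence isomorphisms are suppressed below). A \emph{pivotal pair} $(P,Q)$ in $\mathcal C$ consists of two objects $P,Q$ with chosen morphisms $\mathrm{coev}:\mathbb 1\to P\otimes Q$, $\mathrm{ev}:Q\otimes P\to\mathbb 1$ and $\mathrm{coev}':\mathbb 1\to Q\otimes P$, $\mathrm{ev}':P\otimes Q\to\mathbb 1$, each of the two pairs satisfying the two triangle identities (so that $Q$ is both a left and a right dual of $P$). Let $\mathcal C(P,Q)$ be the category of pairs $(X,\sigma)$ with $X\in\mathcal C$ and $\sigma:X\otimes P\to P\otimes X$ an isomorphism such that $$(\mathrm{ev}\otimes X\otimes Q)(Q\otimes\sigma\otimes Q)(Q\otimes X\otimes\mathrm{coev}):Q\otimes X\to X\otimes Q$$ and $$(Q\otimes X\otimes\mathrm{ev}')(Q\otimes\sigma^{-1}\otimes Q)(\mathrm{coev}'\otimes X\otimes Q):X\otimes Q\to Q\otimes X$$ are inverse to each other; a morphism $(X,\sigma)\to(Y,\tau)$ is a morphism $f:X\to Y$ of $\mathcal C$ with $\tau(f\otimes P)=(P\otimes f)\sigma$. It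 is monoidal via $(X,\sigma)\otimes(Y,\tau)=(X\otimes Y,(\sigma\otimes Y)(X\otimes\tau))$, with unit $\mathbb 1$ carrying the canonical isomorphism. For a strong monoidal functor $U:\mathcal D\to\mathcal C$ with structure isomorphisms $U_2,U_0$, let ${}_{\mathcal D}U_{\mathcal C}^{\circ}$ (the dual, or Majid centralizer, of $U$) be the category of pairs $(X,\tau)$ with $X\in\mathcal C$ and $\tau:X\otimes U(-)\to U(-)\otimes X$ a natural isomorphism such that $(U(M)\otimes\tau_N)(\tau_M\otimes U(N))=(U_2(M,N)^{-1}\otimes X)\,\tau_{M\otimes N}\,(X\otimes U_2(M,N))$ and $(U_0^{-1}\otimes X)\,\tau_{\mathbb 1}\,(X\otimes U_0)=\mathrm{id}_X$; a morphism $(X,\tau)\to(X',\tau')$ is a morphism $f:X\to X'$ with $\tau'_M(f\otimes U(M))=(U(M)\otimes f)\tau_M$ for all $M$. It is monoidal via $(X,\tau)\otimes(X',\tau')=(X\otimes X',(\tau\otimes X')(X\otimes\tau'))$, with unit $\mathbb 1$ carrying the canonical isomorphism. Let $\mathrm{Piv}(1)$ be the monoidal category freely generated by two objects $+,-$ and two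 pairs of duality morphisms making $(+,-)$ a pivotal pair, and let $\omega:\mathrm{Piv}(1)\to\mathcal C$ be the strict monoidal functor sending $+\mapsto P$, $-\mapsto Q$ and the generating duality morphisms to the chosen ones of $(P,Q)$. \textbf{Theorem.} For every pivotal pair $(P,Q)$ in $\mathcal C$ there is an isomorphism of monoidal categories $\mathcal C(P,Q)\cong{}_{\mathrm{Piv}(1)}\omega_{\mathcal C}^{\circ}$, i.e. a pair of mutually inverse strict monoidal functors, which commutes with the forgetful functors $(X,\sigma)\mapsto X$ and $(X,\tau)\mapsto X$ to $\mathcal C$. -/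

import Mathlib

open CategoryTheory MonoidalCategory

universe v v₁ u u₁

namespace PivotalDual

noncomputable section

/-! ### Strict monoidal functors -/

/-- A monoidal functor is strict if it preserves tensor products and the unit on the nose, and its
structure morphisms `F₂` and `F₀` are identities. -/
structure IsStrictMonoidal {D : Type u₁} [Category.{v₁} D] [MonoidalCategory D]
    {C : Type u} [Category.{v} C] [MonoidalCategory C] (F : D ⥤ C) [F.Monoidal] : Prop where
  obj_tensor : ∀ X Y : D, F.obj X ⊗ F.obj Y = F.obj (X ⊗ Y)
  obj_unit : 𝟙_ C = F.obj (𝟙_ D)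
  μ_eq : ∀ X Y : D, Functor.LaxMonoidal.μ F X Y = eqToHom (obj_tensor X Y)
  ε_eq : Functor.LaxMonoidal.ε F = eqToHom obj_unit

/-! ### Pivotal pairs -/

/-- A pivotal pair `(P, Q)`: two objects with `coev : 𝟙 ⟶ P ⊗ Q`, `ev : Q ⊗ P ⟶ 𝟙` and
`coev' : 𝟙 ⟶ Q ⊗ P`, `ev' : P ⊗ Q ⟶ 𝟙`, both satisfying the triangle identities. The choice of
these four morphisms is part of the data. -/
structure PivotalPair (C : Type u) [Category.{v} C] [MonoidalCategory C] where
  P : C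
  Q : C
  pairing : ExactPairing P Q
  pairing' : ExactPairing Q P

section PivotalPair

variable {C : Type u} [Category.{v} C] [MonoidalCategory C]

/-- `coev : 𝟙 ⟶ P ⊗ Q` -/
def PivotalPair.coev (p : PivotalPair C) : 𝟙_ C ⟶ p.P ⊗ p.Q := p.pairing.coevaluation'

/-- `ev : Q ⊗ P ⟶ 𝟙` -/
def PivotalPair.ev (p : PivotalPair C) : p.Q ⊗ p.P ⟶ 𝟙_ C := p.pairing.evaluation'

/-- `coev' : 𝟙 ⟶ Q ⊗ P` -/
def PivotalPair.coev' (p : PivotalPair C) : 𝟙_ C ⟶ p.Q ⊗ p.P := p.pairing'.coevaluation'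

/-- `ev' : P ⊗ Q ⟶ 𝟙` -/
def PivotalPair.ev' (p : PivotalPair C) : p.P ⊗ p.Q ⟶ 𝟙_ C := p.pairing'.evaluation'

theorem PivotalPair.snake (p : PivotalPair C) :
    p.coev ▷ p.P ⊗≫ p.P ◁ p.ev = ⊗𝟙.hom :=
  @ExactPairing.evaluation_coevaluation'' _ _ _ p.P p.Q p.pairing

theorem PivotalPair.snake' (p : PivotalPair C) :
    p.P ◁ p.coev' ⊗≫ p.ev' ▷ p.P = ⊗𝟙.hom :=
  @ExactPairing.coevaluation_evaluation'' _ _ _ p.Q p.P p.pairing'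

theorem PivotalPair.snakeQ (p : PivotalPair C) :
    p.Q ◁ p.coev ⊗≫ p.ev ▷ p.Q = ⊗𝟙.hom :=
  @ExactPairing.coevaluation_evaluation'' _ _ _ p.P p.Q p.pairing

theorem PivotalPair.snakeQ' (p : PivotalPair C) :
    p.coev' ▷ p.Q ⊗≫ p.Q ◁ p.ev' = ⊗𝟙.hom :=
  @ExactPairing.evaluation_coevaluation'' _ _ _ p.Q p.P p.pairing'

end PivotalPair

/-! ### The category of intertwined objects -/

section Intertwined

variable {C : Type u} [Category.{v} C] [MonoidalCategory C] (p : PivotalPair C)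

/-- `(ev ⊗ X ⊗ Q)(Q ⊗ s ⊗ Q)(Q ⊗ X ⊗ coev) : Q ⊗ X ⟶ X ⊗ Q`; the symbol `⊗≫` is composition
with the canonical coherence isomorphism inserted. -/
def inducedHom {X : C} (s : X ⊗ p.P ⟶ p.P ⊗ X) : p.Q ⊗ X ⟶ X ⊗ p.Q :=
  𝟙 (p.Q ⊗ X) ⊗≫ p.Q ◁ X ◁ p.coev ⊗≫ p.Q ◁ s ▷ p.Q ⊗≫ p.ev ▷ X ▷ p.Q ⊗≫ 𝟙 (X ⊗ p.Q)

/-- `(Q ⊗ X ⊗ ev')(Q ⊗ t ⊗ Q)(coev' ⊗ X ⊗ Q) : X ⊗ Q ⟶ Q ⊗ X`, to be used with `t = s⁻¹`. -/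
def inducedInv {X : C} (t : p.P ⊗ X ⟶ X ⊗ p.P) : X ⊗ p.Q ⟶ p.Q ⊗ X :=
  𝟙 (X ⊗ p.Q) ⊗≫ p.coev' ▷ X ▷ p.Q ⊗≫ p.Q ◁ t ▷ p.Q ⊗≫ p.Q ◁ X ◁ p.ev' ⊗≫ 𝟙 (p.Q ⊗ X)

/-- An intertwined object `(X, σ)` for the pivotal pair `(P, Q)`: an invertible
`σ : X ⊗ P ⟶ P ⊗ X` for which the two induced morphisms between `Q ⊗ X` and `X ⊗ Q` are inverse
to each other. -/
@[ext]
structure Intertwined where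
  X : C
  σ : X ⊗ p.P ≅ p.P ⊗ X
  hom_inv : inducedHom p σ.hom ≫ inducedInv p σ.inv = 𝟙 (p.Q ⊗ X)
  inv_hom : inducedInv p σ.inv ≫ inducedHom p σ.hom = 𝟙 (X ⊗ p.Q)

namespace Intertwined

variable {p}

/-- A morphism `(X, σ) ⟶ (Y, τ)`: a morphism `f : X ⟶ Y` with `τ (f ⊗ P) = (P ⊗ f) σ`. -/
@[ext]
structure Hom (A B : Intertwined p) where
  f : A.X ⟶ B.X
  comm : f ▷ p.P ≫ B.σ.hom = A.σ.hom ≫ p.P ◁ f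

instance : Category (Intertwined p) where
  Hom A B := Hom A B
  id A := ⟨𝟙 A.X, by simp⟩
  comp f g := ⟨f.f ≫ g.f, by
    rw [comp_whiskerRight, Category.assoc, g.comm, ← Category.assoc, f.comm, Category.assoc,
      ← MonoidalCategory.whiskerLeft_comp]⟩
  id_comp f := Hom.ext (Category.id_comp _)
  comp_id f := Hom.ext (Category.comp_id _)
  assoc f g h := Hom.ext (Category.assoc _ _ _)

/-- The intertwining `(σ ⊗ Y)(X ⊗ τ)` on `X ⊗ Y`. -/
def tensorσ {X Y : C} (σ : X ⊗ p.P ≅ p.P ⊗ X) (τ : Y ⊗ p.P ≅ p.P ⊗ Y) :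
    (X ⊗ Y) ⊗ p.P ≅ p.P ⊗ (X ⊗ Y) :=
  α_ X Y p.P ≪≫ whiskerLeftIso X τ ≪≫ (α_ X p.P Y).symm ≪≫ whiskerRightIso σ Y ≪≫ α_ p.P X Y

theorem inducedHom_tensor {X Y : C} (σ : X ⊗ p.P ≅ p.P ⊗ X) (τ : Y ⊗ p.P ≅ p.P ⊗ Y) :
    inducedHom p (tensorσ σ τ).hom =
      (α_ p.Q X Y).inv ≫ inducedHom p σ.hom ▷ Y ≫ (α_ X p.Q Y).hom ≫
        X ◁ inducedHom p τ.hom ≫ (α_ X Y p.Q).inv := by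
  symm
  calc
    _ = 𝟙 _ ⊗≫ (p.Q ◁ X ◁ p.coev ⊗≫ p.Q ◁ σ.hom ▷ p.Q ⊗≫ p.ev ▷ (X ⊗ p.Q)) ▷ Y ⊗≫
        X ◁ (p.Q ◁ Y ◁ p.coev) ⊗≫ X ◁ (p.Q ◁ τ.hom ▷ p.Q) ⊗≫ X ◁ (p.ev ▷ (Y ⊗ p.Q)) ⊗≫ 𝟙 _ := by
      dsimp only [inducedHom]; monoidal
    _ = 𝟙 _ ⊗≫ (p.Q ◁ X ◁ p.coev ⊗≫ p.Q ◁ σ.hom ▷ p.Q) ▷ Y ⊗≫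
        ((p.ev ▷ (X ⊗ p.Q ⊗ Y)) ≫ 𝟙_ C ◁ (X ◁ (p.Q ◁ (𝟙 Y ⊗≫ Y ◁ p.coev ⊗≫ τ.hom ▷ p.Q))
          ⊗≫ X ◁ (p.ev ▷ (Y ⊗ p.Q)))) ⊗≫ 𝟙 _ := by
      monoidal
    _ = 𝟙 _ ⊗≫ p.Q ◁ ((X ◁ p.coev) ▷ Y) ⊗≫
        p.Q ◁ (σ.hom ▷ (p.Q ⊗ Y) ≫ (p.P ⊗ X) ◁ (p.Q ◁ (𝟙 Y ⊗≫ Y ◁ p.coev ⊗≫ τ.hom ▷ p.Q)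
          ⊗≫ (p.ev ▷ (Y ⊗ p.Q)))) ⊗≫ p.ev ▷ (X ⊗ Y ⊗ p.Q) ⊗≫ 𝟙 _ := by
      rw [← whisker_exchange]; monoidal
    _ = 𝟙 _ ⊗≫ p.Q ◁ (X ◁ (p.coev ▷ Y ≫ (p.P ⊗ p.Q) ◁ (𝟙 Y ⊗≫ Y ◁ p.coev ⊗≫ τ.hom ▷ p.Q))) ⊗≫
        p.Q ◁ ((X ⊗ p.P) ◁ (p.ev ▷ (Y ⊗ p.Q)) ⊗≫ σ.hom ▷ (Y ⊗ p.Q)) ⊗≫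
         p.ev ▷ (X ⊗ Y ⊗ p.Q) ⊗≫ 𝟙 _ := by
      rw [← whisker_exchange]; monoidal
    _ = 𝟙 _ ⊗≫ p.Q ◁ (X ◁ (Y ◁ p.coev ⊗≫ τ.hom ▷ p.Q)) ⊗≫
        p.Q ◁ X ◁ (p.coev ▷ p.P ⊗≫ p.P ◁ p.ev) ▷ Y ▷ p.Q ⊗≫ p.Q ◁ (σ.hom ▷ (Y ⊗ p.Q)) ⊗≫
         p.ev ▷ (X ⊗ Y ⊗ p.Q) ⊗≫ 𝟙 _ := by
      rw [← whisker_exchange]; monoidal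
    _ = _ := by
      rw [p.snake]; dsimp only [inducedHom, tensorσ]
      simp only [Iso.trans_hom, whiskerLeftIso_hom, Iso.symm_hom, whiskerRightIso_hom]
      monoidal

theorem inducedInv_tensor {X Y : C} (σ : X ⊗ p.P ≅ p.P ⊗ X) (τ : Y ⊗ p.P ≅ p.P ⊗ Y) :
    inducedInv p (tensorσ σ τ).inv =
      (α_ X Y p.Q).hom ≫ X ◁ inducedInv p τ.inv ≫ (α_ X p.Q Y).inv ≫
        inducedInv p σ.inv ▷ Y ≫ (α_ p.Q X Y).hom := by
  symm
  calc
    _ = 𝟙 _ ⊗≫ X ◁ (p.coev' ▷ Y ▷ p.Q ⊗≫ p.Q ◁ τ.inv ▷ p.Q) ⊗≫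
        ((X ⊗ p.Q) ◁ (Y ◁ p.ev') ≫ (𝟙 (X ⊗ p.Q) ⊗≫ p.coev' ▷ X ▷ p.Q ⊗≫ p.Q ◁ σ.inv ▷ p.Q) ▷ (Y ⊗ 𝟙_ C)) ⊗≫
        (p.Q ◁ X ◁ p.ev') ▷ Y ⊗≫ 𝟙 _ := by
      dsimp only [inducedInv]; monoidal
    _ = 𝟙 _ ⊗≫ X ◁ (p.coev' ▷ Y ▷ p.Q) ⊗≫
        ((𝟙_ C) ◁ (X ◁ p.Q ◁ τ.inv ▷ p.Q) ≫ p.coev' ▷ (X ⊗ p.Q ⊗ (Y ⊗ p.P) ⊗ p.Q)) ⊗≫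
        p.Q ◁ σ.inv ▷ p.Q ▷ (Y ⊗ p.P ⊗ p.Q) ⊗≫
        p.Q ◁ X ◁ ((p.P ⊗ p.Q) ◁ (Y ◁ p.ev') ≫ p.ev' ▷ (Y ⊗ 𝟙_ C)) ⊗≫ 𝟙 _ := by
      rw [whisker_exchange]; monoidal
    _ = 𝟙 _ ⊗≫ ((𝟙_ C) ◁ (X ◁ (p.coev' ▷ Y ▷ p.Q)) ≫ p.coev' ▷ (X ⊗ ((p.Q ⊗ p.P) ⊗ Y) ⊗ p.Q)) ⊗≫
        p.Q ◁ ((p.P ⊗ X) ◁ (p.Q ◁ τ.inv ▷ p.Q) ≫ σ.inv ▷ (p.Q ⊗ (Y ⊗ p.P) ⊗ p.Q)) ⊗≫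
        p.Q ◁ X ◁ (p.ev' ▷ (Y ⊗ p.P ⊗ p.Q) ⊗≫ (Y ◁ p.ev')) ⊗≫ 𝟙 _ := by
      rw [whisker_exchange, whisker_exchange]; monoidal
    _ = 𝟙 _ ⊗≫ p.coev' ▷ (X ⊗ Y ⊗ p.Q) ⊗≫
        p.Q ◁ ((p.P ⊗ X) ◁ (p.coev' ▷ Y ▷ p.Q) ≫ σ.inv ▷ (((p.Q ⊗ p.P) ⊗ Y) ⊗ p.Q)) ⊗≫
        p.Q ◁ X ◁ (((p.P ⊗ p.Q) ◁ (τ.inv ▷ p.Q) ≫ p.ev' ▷ ((Y ⊗ p.P) ⊗ p.Q)) ⊗≫ (Y ◁ p.ev')) ⊗≫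
        𝟙 _ := by
      rw [whisker_exchange, whisker_exchange]; monoidal
    _ = 𝟙 _ ⊗≫ p.coev' ▷ (X ⊗ Y ⊗ p.Q) ⊗≫ p.Q ◁ (σ.inv ▷ (Y ⊗ p.Q)) ⊗≫
        p.Q ◁ X ◁ (p.P ◁ p.coev' ⊗≫ p.ev' ▷ p.P) ▷ Y ▷ p.Q ⊗≫
        p.Q ◁ X ◁ (τ.inv ▷ p.Q ⊗≫ Y ◁ p.ev') ⊗≫ 𝟙 _ := by
      rw [whisker_exchange, whisker_exchange]; monoidal
    _ = _ := by
      rw [p.snake']; dsimp only [inducedInv, tensorσ]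
      simp only [Iso.trans_inv, whiskerLeftIso_inv, Iso.symm_inv, whiskerRightIso_inv]
      monoidal

/-- `(X, σ) ⊗ (Y, τ) = (X ⊗ Y, (σ ⊗ Y)(X ⊗ τ))`. -/
def tensorObj (A B : Intertwined p) : Intertwined p where
  X := A.X ⊗ B.X
  σ := tensorσ A.σ B.σ
  hom_inv := by
    rw [inducedHom_tensor, inducedInv_tensor]
    simp only [Category.assoc, Iso.inv_hom_id_assoc]
    rw [← MonoidalCategory.whiskerLeft_comp_assoc, B.hom_inv]
    simp only [MonoidalCategory.whiskerLeft_id, Category.id_comp, Iso.hom_inv_id_assoc]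
    rw [← comp_whiskerRight_assoc, A.hom_inv]
    simp
  inv_hom := by
    rw [inducedHom_tensor, inducedInv_tensor]
    simp only [Category.assoc, Iso.hom_inv_id_assoc]
    rw [← comp_whiskerRight_assoc, A.inv_hom]
    simp only [id_whiskerRight, Category.id_comp, Iso.inv_hom_id_assoc]
    rw [← MonoidalCategory.whiskerLeft_comp_assoc, B.inv_hom]
    simp

theorem inducedHom_unit :
    inducedHom p (λ_ p.P ≪≫ (ρ_ p.P).symm).hom = (ρ_ p.Q).hom ≫ (λ_ p.Q).inv := by
  calc
    _ = 𝟙 _ ⊗≫ (p.Q ◁ p.coev ⊗≫ p.ev ▷ p.Q) ⊗≫ 𝟙 _ := by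
      simp only [inducedHom, Iso.trans_hom, Iso.symm_hom]; monoidal
    _ = _ := by
      rw [p.snakeQ]; monoidal

theorem inducedInv_unit :
    inducedInv p (λ_ p.P ≪≫ (ρ_ p.P).symm).inv = (λ_ p.Q).hom ≫ (ρ_ p.Q).inv := by
  calc
    _ = 𝟙 _ ⊗≫ (p.coev' ▷ p.Q ⊗≫ p.Q ◁ p.ev') ⊗≫ 𝟙 _ := by
      simp only [inducedInv, Iso.trans_inv, Iso.symm_inv]; monoidal
    _ = _ := by
      rw [p.snakeQ']; monoidal

/-- The unit object: `𝟙` with the canonical isomorphism `𝟙 ⊗ P ≅ P ⊗ 𝟙`. -/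
def tensorUnit : Intertwined p where
  X := 𝟙_ C
  σ := λ_ p.P ≪≫ (ρ_ p.P).symm
  hom_inv := by rw [inducedHom_unit, inducedInv_unit]; simp
  inv_hom := by rw [inducedHom_unit, inducedInv_unit]; simp

/-- An isomorphism of underlying objects that is a morphism of intertwined objects is an
isomorphism of intertwined objects. -/
def isoMk {A B : Intertwined p} (e : A.X ≅ B.X)
    (comm : e.hom ▷ p.P ≫ B.σ.hom = A.σ.hom ≫ p.P ◁ e.hom) : A ≅ B where
  hom := ⟨e.hom, comm⟩
  inv := ⟨e.inv, by
    rw [← cancel_epi (e.hom ▷ p.P), hom_inv_whiskerRight_assoc, reassoc_of% comm,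
      ← MonoidalCategory.whiskerLeft_comp, e.hom_inv_id, MonoidalCategory.whiskerLeft_id,
      Category.comp_id]⟩
  hom_inv_id := Hom.ext e.hom_inv_id
  inv_hom_id := Hom.ext e.inv_hom_id

theorem tensorσ_hom {X Y : C} (σ : X ⊗ p.P ≅ p.P ⊗ X) (τ : Y ⊗ p.P ≅ p.P ⊗ Y) :
    (tensorσ σ τ).hom = (α_ X Y p.P).hom ≫ X ◁ τ.hom ≫ (α_ X p.P Y).inv ≫ σ.hom ▷ Y ≫
      (α_ p.P X Y).hom := by
  simp [tensorσ]

theorem tensorHom_comm {A A' B B' : Intertwined p} (f : A ⟶ A') (g : B ⟶ B') :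
    (f.f ⊗ₘ g.f) ▷ p.P ≫ (tensorσ A'.σ B'.σ).hom =
      (tensorσ A.σ B.σ).hom ≫ p.P ◁ (f.f ⊗ₘ g.f) := by
  rw [tensorσ_hom, tensorσ_hom, MonoidalCategory.tensorHom_def]
  calc
    _ = 𝟙 _ ⊗≫ f.f ▷ (B.X ⊗ p.P) ⊗≫ A'.X ◁ (g.f ▷ p.P ≫ B'.σ.hom) ⊗≫ A'.σ.hom ▷ B'.X ⊗≫ 𝟙 _ := by
      monoidal
    _ = 𝟙 _ ⊗≫ (f.f ▷ (B.X ⊗ p.P) ≫ A'.X ◁ B.σ.hom) ⊗≫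
        ((A'.X ⊗ p.P) ◁ g.f ≫ A'.σ.hom ▷ B'.X) ⊗≫ 𝟙 _ := by
      rw [g.comm]; monoidal
    _ = 𝟙 _ ⊗≫ A.X ◁ B.σ.hom ⊗≫ (f.f ▷ p.P ≫ A'.σ.hom) ▷ B.X ⊗≫
        p.P ◁ A'.X ◁ g.f ⊗≫ 𝟙 _ := by
      rw [whisker_exchange, ← whisker_exchange]; monoidal
    _ = _ := by
      rw [f.comm]; monoidal

instance : MonoidalCategoryStruct (Intertwined p) where
  tensorObj := tensorObj
  tensorUnit := tensorUnit
  tensorHom f g := ⟨f.f ⊗ₘ g.f, tensorHom_comm f g⟩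
  whiskerLeft A _ _ g := ⟨A.X ◁ g.f, by
    have := tensorHom_comm (𝟙 A) g
    rwa [show Hom.f (𝟙 A) = 𝟙 A.X from rfl, id_tensorHom] at this⟩
  whiskerRight f B := ⟨f.f ▷ B.X, by
    have := tensorHom_comm f (𝟙 B)
    rwa [show Hom.f (𝟙 B) = 𝟙 B.X from rfl, tensorHom_id] at this⟩
  associator A B D := isoMk (α_ A.X B.X D.X) (by
    dsimp only [tensorObj]; simp only [tensorσ_hom]; monoidal)
  leftUnitor A := isoMk (λ_ A.X) (by
    dsimp only [tensorObj, tensorUnit]; simp only [tensorσ_hom, Iso.trans_hom, Iso.symm_hom]; monoidal)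
  rightUnitor A := isoMk (ρ_ A.X) (by
    dsimp only [tensorObj, tensorUnit]; simp only [tensorσ_hom, Iso.trans_hom, Iso.symm_hom]; monoidal)

variable (p) in
/-- The forgetful functor `(X, σ) ↦ X`. -/
def forget : Intertwined p ⥤ C where
  obj A := A.X
  map f := f.f

instance : (forget p).Faithful where
  map_injective h := Hom.ext h

instance : MonoidalCategory (Intertwined p) where
  tensorHom_def _ _ := Hom.ext (MonoidalCategory.tensorHom_def _ _)
  id_tensorHom_id _ _ := Hom.ext (MonoidalCategory.id_tensorHom_id _ _)
  tensorHom_comp_tensorHom _ _ _ _ := Hom.ext (MonoidalCategory.tensorHom_comp_tensorHom _ _ _ _)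
  whiskerLeft_id _ _ := Hom.ext (MonoidalCategory.whiskerLeft_id _ _)
  id_whiskerRight _ _ := Hom.ext (MonoidalCategory.id_whiskerRight _ _)
  associator_naturality _ _ _ := Hom.ext (MonoidalCategory.associator_naturality _ _ _)
  leftUnitor_naturality _ := Hom.ext (MonoidalCategory.leftUnitor_naturality _)
  rightUnitor_naturality _ := Hom.ext (MonoidalCategory.rightUnitor_naturality _)
  pentagon _ _ _ _ := Hom.ext (MonoidalCategory.pentagon _ _ _ _)
  triangle _ _ := Hom.ext (MonoidalCategory.triangle _ _)

instance : (forget p).Monoidal :=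
  Functor.CoreMonoidal.toMonoidal
    { εIso := Iso.refl (𝟙_ C)
      μIso := fun A B => Iso.refl (A.X ⊗ B.X)
      μIso_hom_natural_left := fun _ _ => (Category.comp_id _).trans (Category.id_comp _).symm
      μIso_hom_natural_right := fun _ _ => (Category.comp_id _).trans (Category.id_comp _).symm
      associativity := fun A B D => by
        change 𝟙 (A.X ⊗ B.X) ▷ D.X ≫ 𝟙 _ ≫ (α_ A.X B.X D.X).hom =
          (α_ A.X B.X D.X).hom ≫ A.X ◁ 𝟙 (B.X ⊗ D.X) ≫ 𝟙 _
        simp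
      left_unitality := fun A => by
        change (λ_ A.X).hom = 𝟙 (𝟙_ C) ▷ A.X ≫ 𝟙 _ ≫ (λ_ A.X).hom
        simp
      right_unitality := fun A => by
        change (ρ_ A.X).hom = A.X ◁ 𝟙 (𝟙_ C) ≫ 𝟙 _ ≫ (ρ_ A.X).hom
        simp }

theorem forget_isStrictMonoidal : IsStrictMonoidal (forget p) where
  obj_tensor _ _ := rfl
  obj_unit := rfl
  μ_eq _ _ := rfl
  ε_eq := rfl

end Intertwined
end Intertwined

/-! ### The dual of a monoidal functor -/

section Dual

open Functor.LaxMonoidal Functor.OplaxMonoidal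

variable {D : Type u₁} [Category.{v₁} D] [MonoidalCategory D]
  {C : Type u} [Category.{v} C] [MonoidalCategory C] (U : D ⥤ C) [U.Monoidal]

/-- An object `(X, τ)` of the dual (centralizer) of a strong monoidal functor `U : D ⥤ C`: a natural
isomorphism `τ : X ⊗ U(-) ⟶ U(-) ⊗ X` with
`(U(M) ⊗ τ_N)(τ_M ⊗ U(N)) = (U₂(M,N)⁻¹ ⊗ X) τ_{M ⊗ N} (X ⊗ U₂(M,N))` and
`(U₀⁻¹ ⊗ X) τ_𝟙 (X ⊗ U₀) = X`. In Mathlib's notation `U₂ = μ U`, `U₂⁻¹ = δ U`, `U₀ = ε U` and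
`U₀⁻¹ = η U`. -/
@[ext]
structure Dual where
  X : C
  τ : ∀ M : D, X ⊗ U.obj M ≅ U.obj M ⊗ X
  naturality : ∀ {M N : D} (f : M ⟶ N), X ◁ U.map f ≫ (τ N).hom = (τ M).hom ≫ U.map f ▷ X
  tensor : ∀ M N : D,
    (α_ X (U.obj M) (U.obj N)).inv ≫ (τ M).hom ▷ U.obj N ≫ (α_ (U.obj M) X (U.obj N)).hom ≫
        U.obj M ◁ (τ N).hom ≫ (α_ (U.obj M) (U.obj N) X).inv =
      X ◁ μ U M N ≫ (τ (M ⊗ N)).hom ≫ δ U M N ▷ X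
  unit : X ◁ ε U ≫ (τ (𝟙_ D)).hom ≫ η U ▷ X = (ρ_ X).hom ≫ (λ_ X).inv

namespace Dual

variable {U}

/-- A morphism `(X, τ) ⟶ (X', τ')`: a morphism `f : X ⟶ X'` with
`τ' (f ⊗ U(-)) = (U(-) ⊗ f) τ`. -/
@[ext]
structure Hom (A B : Dual U) where
  f : A.X ⟶ B.X
  comm : ∀ M : D, f ▷ U.obj M ≫ (B.τ M).hom = (A.τ M).hom ≫ U.obj M ◁ f

instance : Category (Dual U) where
  Hom A B := Hom A B
  id A := ⟨𝟙 A.X, by simp⟩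
  comp f g := ⟨f.f ≫ g.f, fun M => by
    rw [comp_whiskerRight, Category.assoc, g.comm, ← Category.assoc, f.comm, Category.assoc,
      ← MonoidalCategory.whiskerLeft_comp]⟩
  id_comp f := Hom.ext (Category.id_comp _)
  comp_id f := Hom.ext (Category.comp_id _)
  assoc f g h := Hom.ext (Category.assoc _ _ _)

/-- `(τ ⊗ X')(X ⊗ τ')` at the object `Z = U(M)`. -/
def tensorτ {X X' Z : C} (τ : X ⊗ Z ≅ Z ⊗ X) (τ' : X' ⊗ Z ≅ Z ⊗ X') :
    (X ⊗ X') ⊗ Z ≅ Z ⊗ (X ⊗ X') :=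
  α_ X X' Z ≪≫ whiskerLeftIso X τ' ≪≫ (α_ X Z X').symm ≪≫ whiskerRightIso τ X' ≪≫ α_ Z X X'

theorem tensorτ_hom {X X' Z : C} (τ : X ⊗ Z ≅ Z ⊗ X) (τ' : X' ⊗ Z ≅ Z ⊗ X') :
    (tensorτ τ τ').hom = (α_ X X' Z).hom ≫ X ◁ τ'.hom ≫ (α_ X Z X').inv ≫ τ.hom ▷ X' ≫
      (α_ Z X X').hom := by
  simp [tensorτ]

theorem tensorτ_naturality {X X' Z Z' : C} {τ : X ⊗ Z ≅ Z ⊗ X} {τ' : X' ⊗ Z ≅ Z ⊗ X'}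
    {κ : X ⊗ Z' ≅ Z' ⊗ X} {κ' : X' ⊗ Z' ≅ Z' ⊗ X'} (f : Z ⟶ Z')
    (h : X ◁ f ≫ κ.hom = τ.hom ≫ f ▷ X) (h' : X' ◁ f ≫ κ'.hom = τ'.hom ≫ f ▷ X') :
    (X ⊗ X') ◁ f ≫ (tensorτ κ κ').hom = (tensorτ τ τ').hom ≫ f ▷ (X ⊗ X') := by
  rw [tensorτ_hom, tensorτ_hom]
  calc
    _ = 𝟙 _ ⊗≫ X ◁ (X' ◁ f ≫ κ'.hom) ⊗≫ κ.hom ▷ X' ⊗≫ 𝟙 _ := by monoidal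
    _ = 𝟙 _ ⊗≫ X ◁ τ'.hom ⊗≫ (X ◁ f ≫ κ.hom) ▷ X' ⊗≫ 𝟙 _ := by rw [h']; monoidal
    _ = _ := by rw [h]; monoidal

/-- `(X, τ) ⊗ (X', τ') = (X ⊗ X', (τ ⊗ X')(X ⊗ τ'))`. -/
def tensorObj (A B : Dual U) : Dual U where
  X := A.X ⊗ B.X
  τ M := tensorτ (A.τ M) (B.τ M)
  naturality f := tensorτ_naturality _ (A.naturality f) (B.naturality f)
  tensor M N := by
    have hA : A.X ◁ μ U M N ≫ (A.τ (M ⊗ N)).hom = ((α_ _ _ _).inv ≫ (A.τ M).hom ▷ U.obj N ≫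
        (α_ _ _ _).hom ≫ U.obj M ◁ (A.τ N).hom ≫ (α_ _ _ _).inv) ≫ μ U M N ▷ A.X := by
      rw [A.tensor]; simp [← comp_whiskerRight]
    have hB : B.X ◁ μ U M N ≫ (B.τ (M ⊗ N)).hom = ((α_ _ _ _).inv ≫ (B.τ M).hom ▷ U.obj N ≫
        (α_ _ _ _).hom ≫ U.obj M ◁ (B.τ N).hom ≫ (α_ _ _ _).inv) ≫ μ U M N ▷ B.X := by
      rw [B.tensor]; simp [← comp_whiskerRight]
    have h := tensorτ_naturality (τ := (α_ _ _ _).symm ≪≫ whiskerRightIso (A.τ M) (U.obj N) ≪≫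
        (α_ _ _ _) ≪≫ whiskerLeftIso (U.obj M) (A.τ N) ≪≫ (α_ _ _ _).symm)
      (τ' := (α_ _ _ _).symm ≪≫ whiskerRightIso (B.τ M) (U.obj N) ≪≫
        (α_ _ _ _) ≪≫ whiskerLeftIso (U.obj M) (B.τ N) ≪≫ (α_ _ _ _).symm) (μ U M N)
      (by simpa using hA) (by simpa using hB)
    rw [reassoc_of% h, ← comp_whiskerRight, Functor.Monoidal.μ_δ, id_whiskerRight,
      Category.comp_id]
    simp only [tensorτ_hom, Iso.trans_hom, Iso.symm_hom, whiskerRightIso_hom, whiskerLeftIso_hom]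
    calc
      _ = 𝟙 _ ⊗≫ A.X ◁ (B.τ M).hom ▷ U.obj N ⊗≫
          ((A.τ M).hom ▷ (B.X ⊗ U.obj N) ≫ (U.obj M ⊗ A.X) ◁ (B.τ N).hom) ⊗≫
          U.obj M ◁ (A.τ N).hom ▷ B.X ⊗≫ 𝟙 _ := by monoidal
      _ = _ := by rw [← whisker_exchange]; monoidal
  unit := by
    have hA : A.X ◁ ε U ≫ (A.τ (𝟙_ D)).hom = (λ_ A.X ≪≫ (ρ_ A.X).symm).symm.hom ≫ ε U ▷ A.X := by
      have := A.unit =≫ (ε U ▷ A.X)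
      simp only [Category.assoc, ← comp_whiskerRight, Functor.Monoidal.η_ε, id_whiskerRight,
        Category.comp_id] at this
      simpa using this
    have hB : B.X ◁ ε U ≫ (B.τ (𝟙_ D)).hom = (λ_ B.X ≪≫ (ρ_ B.X).symm).symm.hom ≫ ε U ▷ B.X := by
      have := B.unit =≫ (ε U ▷ B.X)
      simp only [Category.assoc, ← comp_whiskerRight, Functor.Monoidal.η_ε, id_whiskerRight,
        Category.comp_id] at this
      simpa using this
    have h := tensorτ_naturality (ε U) hA hB
    rw [reassoc_of% h, ← comp_whiskerRight, Functor.Monoidal.ε_η, id_whiskerRight,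
      Category.comp_id]
    simp only [tensorτ_hom, Iso.symm_hom, Iso.trans_inv, Iso.symm_inv]
    monoidal

/-- The unit object: `𝟙` with the canonical isomorphism `𝟙 ⊗ U(-) ≅ U(-) ⊗ 𝟙`. -/
def tensorUnit : Dual U where
  X := 𝟙_ C
  τ M := λ_ (U.obj M) ≪≫ (ρ_ (U.obj M)).symm
  naturality f := by simp
  tensor M N := by
    simp only [Iso.trans_hom, Iso.symm_hom]
    have : 𝟙_ C ◁ μ U M N ≫ (λ_ (U.obj (M ⊗ N))).hom ≫ (ρ_ (U.obj (M ⊗ N))).inv ≫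
        δ U M N ▷ 𝟙_ C = (λ_ _).hom ≫ (ρ_ _).inv := by simp
    rw [Category.assoc, this]
    monoidal
  unit := by
    simp only [Iso.trans_hom, Iso.symm_hom, Category.assoc]
    rw [← rightUnitor_inv_naturality, leftUnitor_naturality_assoc, Functor.Monoidal.ε_η_assoc,
      unitors_equal, unitors_inv_equal]

/-- An isomorphism of underlying objects that is a morphism of the dual is an isomorphism of the
dual. -/
def isoMk {A B : Dual U} (e : A.X ≅ B.X)
    (comm : ∀ M : D, e.hom ▷ U.obj M ≫ (B.τ M).hom = (A.τ M).hom ≫ U.obj M ◁ e.hom) : A ≅ B where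
  hom := ⟨e.hom, comm⟩
  inv := ⟨e.inv, fun M => by
    rw [← cancel_epi (e.hom ▷ U.obj M), hom_inv_whiskerRight_assoc, reassoc_of% (comm M),
      ← MonoidalCategory.whiskerLeft_comp, e.hom_inv_id, MonoidalCategory.whiskerLeft_id,
      Category.comp_id]⟩
  hom_inv_id := Hom.ext e.hom_inv_id
  inv_hom_id := Hom.ext e.inv_hom_id

theorem tensorHom_comm {A A' B B' : Dual U} (f : A ⟶ A') (g : B ⟶ B') (M : D) :
    (f.f ⊗ₘ g.f) ▷ U.obj M ≫ (tensorτ (A'.τ M) (B'.τ M)).hom =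
      (tensorτ (A.τ M) (B.τ M)).hom ≫ U.obj M ◁ (f.f ⊗ₘ g.f) := by
  rw [tensorτ_hom, tensorτ_hom, MonoidalCategory.tensorHom_def]
  calc
    _ = 𝟙 _ ⊗≫ f.f ▷ (B.X ⊗ U.obj M) ⊗≫ A'.X ◁ (g.f ▷ U.obj M ≫ (B'.τ M).hom) ⊗≫
        (A'.τ M).hom ▷ B'.X ⊗≫ 𝟙 _ := by
      monoidal
    _ = 𝟙 _ ⊗≫ (f.f ▷ (B.X ⊗ U.obj M) ≫ A'.X ◁ (B.τ M).hom) ⊗≫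
        ((A'.X ⊗ U.obj M) ◁ g.f ≫ (A'.τ M).hom ▷ B'.X) ⊗≫ 𝟙 _ := by
      rw [g.comm]; monoidal
    _ = 𝟙 _ ⊗≫ A.X ◁ (B.τ M).hom ⊗≫ (f.f ▷ U.obj M ≫ (A'.τ M).hom) ▷ B.X ⊗≫
        U.obj M ◁ A'.X ◁ g.f ⊗≫ 𝟙 _ := by
      rw [whisker_exchange, ← whisker_exchange]; monoidal
    _ = _ := by
      rw [f.comm]; monoidal

instance : MonoidalCategoryStruct (Dual U) where
  tensorObj := tensorObj
  tensorUnit := tensorUnit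
  tensorHom f g := ⟨f.f ⊗ₘ g.f, tensorHom_comm f g⟩
  whiskerLeft A _ _ g := ⟨A.X ◁ g.f, fun M => by
    have := tensorHom_comm (𝟙 A) g M
    rwa [show Hom.f (𝟙 A) = 𝟙 A.X from rfl, id_tensorHom] at this⟩
  whiskerRight f B := ⟨f.f ▷ B.X, fun M => by
    have := tensorHom_comm f (𝟙 B) M
    rwa [show Hom.f (𝟙 B) = 𝟙 B.X from rfl, tensorHom_id] at this⟩
  associator A B E := isoMk (α_ A.X B.X E.X) (fun M => by
    dsimp only [tensorObj]; simp only [tensorτ_hom]; monoidal)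
  leftUnitor A := isoMk (λ_ A.X) (fun M => by
    dsimp only [tensorObj, tensorUnit]
    simp only [tensorτ_hom, Iso.trans_hom, Iso.symm_hom]; monoidal)
  rightUnitor A := isoMk (ρ_ A.X) (fun M => by
    dsimp only [tensorObj, tensorUnit]
    simp only [tensorτ_hom, Iso.trans_hom, Iso.symm_hom]; monoidal)

instance : MonoidalCategory (Dual U) where
  tensorHom_def _ _ := Hom.ext (MonoidalCategory.tensorHom_def _ _)
  id_tensorHom_id _ _ := Hom.ext (MonoidalCategory.id_tensorHom_id _ _)
  tensorHom_comp_tensorHom _ _ _ _ := Hom.ext (MonoidalCategory.tensorHom_comp_tensorHom _ _ _ _)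
  whiskerLeft_id _ _ := Hom.ext (MonoidalCategory.whiskerLeft_id _ _)
  id_whiskerRight _ _ := Hom.ext (MonoidalCategory.id_whiskerRight _ _)
  associator_naturality _ _ _ := Hom.ext (MonoidalCategory.associator_naturality _ _ _)
  leftUnitor_naturality _ := Hom.ext (MonoidalCategory.leftUnitor_naturality _)
  rightUnitor_naturality _ := Hom.ext (MonoidalCategory.rightUnitor_naturality _)
  pentagon _ _ _ _ := Hom.ext (MonoidalCategory.pentagon _ _ _ _)
  triangle _ _ := Hom.ext (MonoidalCategory.triangle _ _)

variable (U) in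
/-- The forgetful functor `(X, τ) ↦ X`. -/
def forget : Dual U ⥤ C where
  obj A := A.X
  map f := f.f

instance : (forget U).Monoidal :=
  Functor.CoreMonoidal.toMonoidal
    { εIso := Iso.refl (𝟙_ C)
      μIso := fun A B => Iso.refl (A.X ⊗ B.X)
      μIso_hom_natural_left := fun _ _ => (Category.comp_id _).trans (Category.id_comp _).symm
      μIso_hom_natural_right := fun _ _ => (Category.comp_id _).trans (Category.id_comp _).symm
      associativity := fun A B E => by
        change 𝟙 (A.X ⊗ B.X) ▷ E.X ≫ 𝟙 _ ≫ (α_ A.X B.X E.X).hom =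
          (α_ A.X B.X E.X).hom ≫ A.X ◁ 𝟙 (B.X ⊗ E.X) ≫ 𝟙 _
        simp
      left_unitality := fun A => by
        change (λ_ A.X).hom = 𝟙 (𝟙_ C) ▷ A.X ≫ 𝟙 _ ≫ (λ_ A.X).hom
        simp
      right_unitality := fun A => by
        change (ρ_ A.X).hom = A.X ◁ 𝟙 (𝟙_ C) ≫ 𝟙 _ ≫ (ρ_ A.X).hom
        simp }

theorem forget_isStrictMonoidal : IsStrictMonoidal (forget U) where
  obj_tensor _ _ := rfl
  obj_unit := rfl
  μ_eq _ _ := rfl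
  ε_eq := rfl

end Dual
end Dual

/-! ### The free monoidal category on a pivotal pair -/

/-- Objects of `Piv`: formal tensor products of the two generating objects `pos` (written `+`) and
`neg` (written `-`). -/
inductive Piv : Type
  | pos : Piv
  | neg : Piv
  | unit : Piv
  | tensor : Piv → Piv → Piv

namespace Piv

/-- Formal morphisms of `Piv`: generated under composition and tensor product by identities, the
coherence morphisms, and two pairs of duality morphisms. -/
inductive Hom : Piv → Piv → Type
  | coev : Hom unit (pos.tensor neg)
  | ev : Hom (neg.tensor pos) unit
  | coev' : Hom unit (neg.tensor pos)
  | ev' : Hom (pos.tensor neg) unit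
  | id (X : Piv) : Hom X X
  | α_hom (X Y Z : Piv) : Hom ((X.tensor Y).tensor Z) (X.tensor (Y.tensor Z))
  | α_inv (X Y Z : Piv) : Hom (X.tensor (Y.tensor Z)) ((X.tensor Y).tensor Z)
  | l_hom (X : Piv) : Hom (unit.tensor X) X
  | l_inv (X : Piv) : Hom X (unit.tensor X)
  | ρ_hom (X : Piv) : Hom (X.tensor unit) X
  | ρ_inv (X : Piv) : Hom X (X.tensor unit)
  | comp {X Y Z : Piv} (f : Hom X Y) (g : Hom Y Z) : Hom X Z
  | whiskerLeft (X : Piv) {Y Z : Piv} (f : Hom Y Z) : Hom (X.tensor Y) (X.tensor Z)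
  | whiskerRight {X Y : Piv} (f : Hom X Y) (Z : Piv) : Hom (X.tensor Z) (Y.tensor Z)

/-- The relations between formal morphisms: the axioms of a monoidal category, and the four triangle
identities making `neg` both a left and a right dual of `pos`. -/
inductive Rel : ∀ {X Y : Piv}, Hom X Y → Hom X Y → Prop
  | refl {X Y : Piv} (f : Hom X Y) : Rel f f
  | symm {X Y : Piv} {f g : Hom X Y} : Rel f g → Rel g f
  | trans {X Y : Piv} {f g h : Hom X Y} : Rel f g → Rel g h → Rel f h
  | comp {X Y Z : Piv} {f f' : Hom X Y} {g g' : Hom Y Z} :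
      Rel f f' → Rel g g' → Rel (f.comp g) (f'.comp g')
  | whiskerLeft (X : Piv) {Y Z : Piv} {f f' : Hom Y Z} :
      Rel f f' → Rel (f.whiskerLeft X) (f'.whiskerLeft X)
  | whiskerRight {X Y : Piv} {f f' : Hom X Y} (Z : Piv) :
      Rel f f' → Rel (f.whiskerRight Z) (f'.whiskerRight Z)
  | comp_id {X Y : Piv} (f : Hom X Y) : Rel (f.comp (Hom.id Y)) f
  | id_comp {X Y : Piv} (f : Hom X Y) : Rel ((Hom.id X).comp f) f
  | assoc {W X Y Z : Piv} (f : Hom W X) (g : Hom X Y) (h : Hom Y Z) :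
      Rel ((f.comp g).comp h) (f.comp (g.comp h))
  | whiskerLeft_id (X Y : Piv) : Rel ((Hom.id Y).whiskerLeft X) (Hom.id (X.tensor Y))
  | whiskerLeft_comp (W : Piv) {X Y Z : Piv} (f : Hom X Y) (g : Hom Y Z) :
      Rel ((f.comp g).whiskerLeft W) ((f.whiskerLeft W).comp (g.whiskerLeft W))
  | id_whiskerRight (X Y : Piv) : Rel ((Hom.id X).whiskerRight Y) (Hom.id (X.tensor Y))
  | comp_whiskerRight {W X Y : Piv} (f : Hom W X) (g : Hom X Y) (Z : Piv) :
      Rel ((f.comp g).whiskerRight Z) ((f.whiskerRight Z).comp (g.whiskerRight Z))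
  | whisker_exchange {W X Y Z : Piv} (f : Hom W X) (g : Hom Y Z) :
      Rel ((g.whiskerLeft W).comp (f.whiskerRight Z)) ((f.whiskerRight Y).comp (g.whiskerLeft X))
  | α_hom_inv (X Y Z : Piv) : Rel ((Hom.α_hom X Y Z).comp (Hom.α_inv X Y Z)) (Hom.id _)
  | α_inv_hom (X Y Z : Piv) : Rel ((Hom.α_inv X Y Z).comp (Hom.α_hom X Y Z)) (Hom.id _)
  | α_naturality_left {X X' : Piv} (f : Hom X X') (Y Z : Piv) :
      Rel (((f.whiskerRight Y).whiskerRight Z).comp (Hom.α_hom X' Y Z))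
        ((Hom.α_hom X Y Z).comp (f.whiskerRight (Y.tensor Z)))
  | α_naturality_middle (X : Piv) {Y Y' : Piv} (f : Hom Y Y') (Z : Piv) :
      Rel (((f.whiskerLeft X).whiskerRight Z).comp (Hom.α_hom X Y' Z))
        ((Hom.α_hom X Y Z).comp ((f.whiskerRight Z).whiskerLeft X))
  | α_naturality_right (X Y : Piv) {Z Z' : Piv} (f : Hom Z Z') :
      Rel ((f.whiskerLeft (X.tensor Y)).comp (Hom.α_hom X Y Z'))
        ((Hom.α_hom X Y Z).comp ((f.whiskerLeft Y).whiskerLeft X))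
  | ρ_hom_inv (X : Piv) : Rel ((Hom.ρ_hom X).comp (Hom.ρ_inv X)) (Hom.id _)
  | ρ_inv_hom (X : Piv) : Rel ((Hom.ρ_inv X).comp (Hom.ρ_hom X)) (Hom.id _)
  | ρ_naturality {X Y : Piv} (f : Hom X Y) :
      Rel ((f.whiskerRight unit).comp (Hom.ρ_hom Y)) ((Hom.ρ_hom X).comp f)
  | l_hom_inv (X : Piv) : Rel ((Hom.l_hom X).comp (Hom.l_inv X)) (Hom.id _)
  | l_inv_hom (X : Piv) : Rel ((Hom.l_inv X).comp (Hom.l_hom X)) (Hom.id _)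
  | l_naturality {X Y : Piv} (f : Hom X Y) :
      Rel ((f.whiskerLeft unit).comp (Hom.l_hom Y)) ((Hom.l_hom X).comp f)
  | pentagon (W X Y Z : Piv) :
      Rel (((Hom.α_hom W X Y).whiskerRight Z).comp
          ((Hom.α_hom W (X.tensor Y) Z).comp ((Hom.α_hom X Y Z).whiskerLeft W)))
        ((Hom.α_hom (W.tensor X) Y Z).comp (Hom.α_hom W X (Y.tensor Z)))
  | triangle (X Y : Piv) :
      Rel ((Hom.α_hom X unit Y).comp ((Hom.l_hom Y).whiskerLeft X)) ((Hom.ρ_hom X).whiskerRight Y)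
  | snake_neg :
      Rel ((Hom.coev.whiskerLeft neg).comp
          ((Hom.α_inv neg pos neg).comp (Hom.ev.whiskerRight neg)))
        ((Hom.ρ_hom neg).comp (Hom.l_inv neg))
  | snake_pos :
      Rel ((Hom.coev.whiskerRight pos).comp
          ((Hom.α_hom pos neg pos).comp (Hom.ev.whiskerLeft pos)))
        ((Hom.l_hom pos).comp (Hom.ρ_inv pos))
  | snake_pos' :
      Rel ((Hom.coev'.whiskerLeft pos).comp
          ((Hom.α_inv pos neg pos).comp (Hom.ev'.whiskerRight pos)))
        ((Hom.ρ_hom pos).comp (Hom.l_inv pos))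
  | snake_neg' :
      Rel ((Hom.coev'.whiskerRight neg).comp
          ((Hom.α_hom neg pos neg).comp (Hom.ev'.whiskerLeft neg)))
        ((Hom.l_hom neg).comp (Hom.ρ_inv neg))

instance setoidHom (X Y : Piv) : Setoid (Hom X Y) := ⟨Rel, ⟨Rel.refl, Rel.symm, Rel.trans⟩⟩

/-- Morphisms of `Piv` are formal morphisms modulo the relations. -/
instance : Category Piv where
  Hom X Y := Quotient (setoidHom X Y)
  id X := ⟦Hom.id X⟧
  comp := Quotient.map₂ Hom.comp (fun _ _ hf _ _ hg => Rel.comp hf hg)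
  id_comp := by rintro X Y ⟨f⟩; exact Quotient.sound (Rel.id_comp f)
  comp_id := by rintro X Y ⟨f⟩; exact Quotient.sound (Rel.comp_id f)
  assoc := by rintro W X Y Z ⟨f⟩ ⟨g⟩ ⟨h⟩; exact Quotient.sound (Rel.assoc f g h)

/-- The morphism of `Piv` represented by a formal morphism. -/
def mk {X Y : Piv} (f : Hom X Y) : X ⟶ Y := Quotient.mk (setoidHom X Y) f

instance : MonoidalCategoryStruct Piv where
  tensorObj := Piv.tensor
  tensorUnit := Piv.unit
  whiskerLeft X _ _ := Quotient.map (Hom.whiskerLeft X) (fun _ _ h => Rel.whiskerLeft X h)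
  whiskerRight f Z :=
    Quotient.map (fun f => Hom.whiskerRight f Z) (fun _ _ h => Rel.whiskerRight Z h) f
  associator X Y Z :=
    ⟨mk (Hom.α_hom X Y Z), mk (Hom.α_inv X Y Z), Quotient.sound (Rel.α_hom_inv X Y Z),
      Quotient.sound (Rel.α_inv_hom X Y Z)⟩
  leftUnitor X :=
    ⟨mk (Hom.l_hom X), mk (Hom.l_inv X), Quotient.sound (Rel.l_hom_inv X),
      Quotient.sound (Rel.l_inv_hom X)⟩
  rightUnitor X :=
    ⟨mk (Hom.ρ_hom X), mk (Hom.ρ_inv X), Quotient.sound (Rel.ρ_hom_inv X),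
      Quotient.sound (Rel.ρ_inv_hom X)⟩

instance : MonoidalCategory Piv :=
  have wc : ∀ (W : Piv) {X Y Z : Piv} (f : X ⟶ Y) (g : Y ⟶ Z), W ◁ (f ≫ g) = W ◁ f ≫ W ◁ g := by
    rintro W X Y Z ⟨f⟩ ⟨g⟩; exact Quotient.sound (Rel.whiskerLeft_comp W f g)
  have cw : ∀ {W X Y : Piv} (f : W ⟶ X) (g : X ⟶ Y) (Z : Piv), (f ≫ g) ▷ Z = f ▷ Z ≫ g ▷ Z := by
    rintro W X Y ⟨f⟩ ⟨g⟩ Z; exact Quotient.sound (Rel.comp_whiskerRight f g Z)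
  have we : ∀ {W X Y Z : Piv} (f : W ⟶ X) (g : Y ⟶ Z), W ◁ g ≫ f ▷ Z = f ▷ Y ≫ X ◁ g := by
    rintro W X Y Z ⟨f⟩ ⟨g⟩; exact Quotient.sound (Rel.whisker_exchange f g)
  have wi : ∀ X Y : Piv, X ◁ 𝟙 Y = 𝟙 (X ⊗ Y) := fun X Y =>
    Quotient.sound (Rel.whiskerLeft_id X Y)
  have iw : ∀ X Y : Piv, 𝟙 X ▷ Y = 𝟙 (X ⊗ Y) := fun X Y =>
    Quotient.sound (Rel.id_whiskerRight X Y)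
  have th : ∀ {X₁ Y₁ X₂ Y₂ : Piv} (f : X₁ ⟶ Y₁) (g : X₂ ⟶ Y₂), f ⊗ₘ g = f ▷ X₂ ≫ Y₁ ◁ g :=
    fun _ _ => rfl
  have nl : ∀ {X X' : Piv} (f : X ⟶ X') (Y Z : Piv),
      f ▷ Y ▷ Z ≫ (α_ X' Y Z).hom = (α_ X Y Z).hom ≫ f ▷ (Y ⊗ Z) := by
    rintro X X' ⟨f⟩ Y Z; exact Quotient.sound (Rel.α_naturality_left f Y Z)
  have nm : ∀ (X : Piv) {Y Y' : Piv} (f : Y ⟶ Y') (Z : Piv),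
      (X ◁ f) ▷ Z ≫ (α_ X Y' Z).hom = (α_ X Y Z).hom ≫ X ◁ f ▷ Z := by
    rintro X Y Y' ⟨f⟩ Z; exact Quotient.sound (Rel.α_naturality_middle X f Z)
  have nr : ∀ (X Y : Piv) {Z Z' : Piv} (f : Z ⟶ Z'),
      (X ⊗ Y) ◁ f ≫ (α_ X Y Z').hom = (α_ X Y Z).hom ≫ X ◁ Y ◁ f := by
    rintro X Y Z Z' ⟨f⟩; exact Quotient.sound (Rel.α_naturality_right X Y f)
  { tensorHom_def := th
    id_tensorHom_id := fun X Y => by rw [th, wi, iw, Category.comp_id]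
    tensorHom_comp_tensorHom := fun f₁ f₂ g₁ g₂ => by
      simp only [th, wc, cw, Category.assoc]
      rw [← Category.assoc (_ ◁ f₂), we, Category.assoc]
    whiskerLeft_id := wi
    id_whiskerRight := iw
    associator_naturality := fun f₁ f₂ f₃ => by
      simp only [th, wc, cw, Category.assoc]
      rw [nr, ← Category.assoc ((_ ◁ f₂) ▷ _), nm, Category.assoc, ← Category.assoc (f₁ ▷ _ ▷ _),
        nl, Category.assoc]
    leftUnitor_naturality := by
      rintro X Y ⟨f⟩; exact Quotient.sound (Rel.l_naturality f)
    rightUnitor_naturality := by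
      rintro X Y ⟨f⟩; exact Quotient.sound (Rel.ρ_naturality f)
    pentagon := fun W X Y Z => Quotient.sound (Rel.pentagon W X Y Z)
    triangle := fun X Y => Quotient.sound (Rel.triangle X Y) }

/-- The generating pivotal pair `(+, -)` of `Piv`. -/
def pair : PivotalPair Piv where
  P := pos
  Q := neg
  pairing :=
    { coevaluation' := mk Hom.coev
      evaluation' := mk Hom.ev
      coevaluation_evaluation' := Quotient.sound Rel.snake_neg
      evaluation_coevaluation' := Quotient.sound Rel.snake_pos }
  pairing' :=
    { coevaluation' := mk Hom.coev'
      evaluation' := mk Hom.ev'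
      coevaluation_evaluation' := Quotient.sound Rel.snake_pos'
      evaluation_coevaluation' := Quotient.sound Rel.snake_neg' }

end Piv

/-! ### The strict monoidal functor classified by a pivotal pair -/

section Classifying

variable {C : Type u} [Category.{v} C] [MonoidalCategory C] (p : PivotalPair C)

/-- The functor `ω` on objects: `+ ↦ P`, `- ↦ Q`. -/
def ωObj : Piv → C
  | .pos => p.P
  | .neg => p.Q
  | .unit => 𝟙_ C
  | .tensor X Y => ωObj X ⊗ ωObj Y

/-- The functor `ω` on formal morphisms: duality morphisms go to the chosen duality morphisms of
`(P, Q)`. -/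
def ωHom : ∀ {X Y : Piv}, Piv.Hom X Y → (ωObj p X ⟶ ωObj p Y)
  | _, _, .coev => p.coev
  | _, _, .ev => p.ev
  | _, _, .coev' => p.coev'
  | _, _, .ev' => p.ev'
  | _, _, .id X => 𝟙 (ωObj p X)
  | _, _, .α_hom X Y Z => (α_ (ωObj p X) (ωObj p Y) (ωObj p Z)).hom
  | _, _, .α_inv X Y Z => (α_ (ωObj p X) (ωObj p Y) (ωObj p Z)).inv
  | _, _, .l_hom X => (λ_ (ωObj p X)).hom
  | _, _, .l_inv X => (λ_ (ωObj p X)).inv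
  | _, _, .ρ_hom X => (ρ_ (ωObj p X)).hom
  | _, _, .ρ_inv X => (ρ_ (ωObj p X)).inv
  | _, _, .comp f g => ωHom f ≫ ωHom g
  | _, _, .whiskerLeft X f => ωObj p X ◁ ωHom f
  | _, _, .whiskerRight f Z => ωHom f ▷ ωObj p Z

theorem ωHom_rel {X Y : Piv} {f g : Piv.Hom X Y} (h : Piv.Rel f g) : ωHom p f = ωHom p g := by
  induction h with
  | refl f => rfl
  | symm _ ih => exact ih.symm
  | trans _ _ ih₁ ih₂ => exact ih₁.trans ih₂
  | comp _ _ ih₁ ih₂ => exact congr_arg₂ (· ≫ ·) ih₁ ih₂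
  | whiskerLeft X _ ih => exact congr_arg (ωObj p X ◁ ·) ih
  | whiskerRight Z _ ih => exact congr_arg (· ▷ ωObj p Z) ih
  | comp_id f => exact Category.comp_id _
  | id_comp f => exact Category.id_comp _
  | assoc f g h => exact Category.assoc _ _ _
  | whiskerLeft_id X Y => exact MonoidalCategory.whiskerLeft_id _ _
  | whiskerLeft_comp W f g => exact MonoidalCategory.whiskerLeft_comp _ _ _
  | id_whiskerRight X Y => exact MonoidalCategory.id_whiskerRight _ _
  | comp_whiskerRight f g Z => exact MonoidalCategory.comp_whiskerRight _ _ _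
  | whisker_exchange f g => exact MonoidalCategory.whisker_exchange _ _
  | α_hom_inv X Y Z => exact Iso.hom_inv_id _
  | α_inv_hom X Y Z => exact Iso.inv_hom_id _
  | α_naturality_left f Y Z => exact MonoidalCategory.associator_naturality_left _ _ _
  | α_naturality_middle X f Z => exact MonoidalCategory.associator_naturality_middle _ _ _
  | α_naturality_right X Y f => exact MonoidalCategory.associator_naturality_right _ _ _
  | ρ_hom_inv X => exact Iso.hom_inv_id _
  | ρ_inv_hom X => exact Iso.inv_hom_id _
  | ρ_naturality f => exact MonoidalCategory.rightUnitor_naturality _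
  | l_hom_inv X => exact Iso.hom_inv_id _
  | l_inv_hom X => exact Iso.inv_hom_id _
  | l_naturality f => exact MonoidalCategory.leftUnitor_naturality _
  | pentagon W X Y Z => exact MonoidalCategory.pentagon _ _ _ _
  | triangle X Y => exact MonoidalCategory.triangle _ _
  | snake_neg => exact p.pairing.coevaluation_evaluation'
  | snake_pos => exact p.pairing.evaluation_coevaluation'
  | snake_pos' => exact p.pairing'.coevaluation_evaluation'
  | snake_neg' => exact p.pairing'.evaluation_coevaluation'

/-- The functor `ω : Piv ⥤ C` classified by the pivotal pair `(P, Q)`. -/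
def ω : Piv ⥤ C where
  obj := ωObj p
  map f := Quotient.lift (ωHom p) (fun _ _ h => ωHom_rel p h) f
  map_id _ := rfl
  map_comp := by rintro _ _ _ ⟨f⟩ ⟨g⟩; rfl

instance : (ω p).Monoidal :=
  Functor.CoreMonoidal.toMonoidal
    { εIso := Iso.refl (𝟙_ C)
      μIso := fun X Y => Iso.refl (ωObj p X ⊗ ωObj p Y)
      μIso_hom_natural_left := by
        rintro _ _ ⟨f⟩ _; exact (Category.comp_id _).trans (Category.id_comp _).symm
      μIso_hom_natural_right := by
        rintro _ _ _ ⟨f⟩; exact (Category.comp_id _).trans (Category.id_comp _).symm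
      associativity := fun X Y Z => by
        change 𝟙 (ωObj p X ⊗ ωObj p Y) ▷ ωObj p Z ≫ 𝟙 _ ≫
            (α_ (ωObj p X) (ωObj p Y) (ωObj p Z)).hom =
          (α_ (ωObj p X) (ωObj p Y) (ωObj p Z)).hom ≫ ωObj p X ◁ 𝟙 (ωObj p Y ⊗ ωObj p Z) ≫ 𝟙 _
        simp
      left_unitality := fun X => by
        change (λ_ (ωObj p X)).hom = 𝟙 (𝟙_ C) ▷ ωObj p X ≫ 𝟙 _ ≫ (λ_ (ωObj p X)).hom
        simp
      right_unitality := fun X => by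
        change (ρ_ (ωObj p X)).hom = ωObj p X ◁ 𝟙 (𝟙_ C) ≫ 𝟙 _ ≫ (ρ_ (ωObj p X)).hom
        simp }

theorem ω_isStrictMonoidal : IsStrictMonoidal (ω p) where
  obj_tensor _ _ := rfl
  obj_unit := rfl
  μ_eq _ _ := rfl
  ε_eq := rfl

theorem ω_pos : (ω p).obj Piv.pair.P = p.P := rfl

theorem ω_neg : (ω p).obj Piv.pair.Q = p.Q := rfl

theorem ω_coev : (ω p).map Piv.pair.coev = p.coev := rfl

theorem ω_ev : (ω p).map Piv.pair.ev = p.ev := rfl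

theorem ω_coev' : (ω p).map Piv.pair.coev' = p.coev' := rfl

theorem ω_ev' : (ω p).map Piv.pair.ev' = p.ev' := rfl

end Classifying

end

end PivotalDual

namespace PivotalDual

noncomputable section

variable {C : Type u} [Category.{v} C] [MonoidalCategory C] {p : PivotalPair C}

/-! A centralizer structure `τ` on `X` over `Piv` amounts to its component `σ` at `+`. The tensor
and unit axioms compute `τ` on every formal tensor product from the components at `+` and `-`, since
`ω` is strict. The component at `-` is then forced by duality: naturality at `ev` makes its inverse
the mate `inducedHom` of `σ`, and naturality at `ev'` makes it the mate `inducedInv` of the inverse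
of `σ`. So the two mates are mutually inverse, which is exactly the condition defining an
intertwined object.

Conversely, from such a `σ` one takes `inducedInv` as the component at `-` and extends by the tensor
recursion (`extend`). Naturality need only be checked on generating morphisms. Coherence morphisms
and whiskerings are formal, so the content is at the four duality morphisms: for `coev` and `ev` it
is the mutual inverse condition, for `coev'` and `ev'` the invertibility of `σ` suffices.

Both passages keep the underlying object and morphisms. Evaluation at `+` is strict monoidal by
definition, and strictness of the extension follows because it is the inverse of evaluation. -/

/-! ### Mates under the dualities: bending identities and uniqueness. -/

/-- The outer `coev` slides past the `coev` and the `s` inside the mate, then cancels against the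
inner `ev` by a triangle identity on the `P`-strand. The next three lemmas are the variants for the
other duality morphisms; none needs `s` or `t` to be invertible. -/
theorem coev_inducedHom {X : C} (s : X ⊗ p.P ⟶ p.P ⊗ X) :
    p.coev ▷ X ⊗≫ p.P ◁ inducedHom p s =
      (λ_ X).hom ≫ (ρ_ X).inv ≫ X ◁ p.coev ⊗≫ s ▷ p.Q ⊗≫ 𝟙 _ := by
  calc
    -- The idle factor `𝟙_ C` is the source of the second `coev`; inserting it puts two morphisms on
    -- disjoint strands into the form required by `whisker_exchange`.
    _ = 𝟙 _ ⊗≫ (p.coev ▷ (X ⊗ 𝟙_ C) ≫ (p.P ⊗ p.Q) ◁ (X ◁ p.coev)) ⊗≫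
        p.P ◁ p.Q ◁ s ▷ p.Q ⊗≫ p.P ◁ p.ev ▷ X ▷ p.Q ⊗≫ 𝟙 _ := by
      dsimp only [inducedHom]; monoidal
    _ = 𝟙 _ ⊗≫ X ◁ p.coev ⊗≫
        (p.coev ▷ ((X ⊗ p.P) ⊗ p.Q) ≫ (p.P ⊗ p.Q) ◁ (s ▷ p.Q)) ⊗≫
        p.P ◁ p.ev ▷ X ▷ p.Q ⊗≫ 𝟙 _ := by
      rw [← whisker_exchange]; monoidal
    _ = 𝟙 _ ⊗≫ X ◁ p.coev ⊗≫ s ▷ p.Q ⊗≫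
        (p.coev ▷ p.P ⊗≫ p.P ◁ p.ev) ▷ (X ⊗ p.Q) ⊗≫ 𝟙 _ := by
      rw [← whisker_exchange]; monoidal
    _ = _ := by rw [p.snake]; monoidal

theorem inducedHom_ev {X : C} (s : X ⊗ p.P ⟶ p.P ⊗ X) :
    inducedHom p s ▷ p.P ⊗≫ X ◁ p.ev = 𝟙 _ ⊗≫ p.Q ◁ s ⊗≫ p.ev ▷ X ≫ (λ_ X).hom ≫ (ρ_ X).inv := by
  calc
    _ = 𝟙 _ ⊗≫ p.Q ◁ X ◁ p.coev ▷ p.P ⊗≫ p.Q ◁ s ▷ (p.Q ⊗ p.P) ⊗≫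
        (p.ev ▷ (X ⊗ p.Q ⊗ p.P) ≫ 𝟙_ C ◁ (X ◁ p.ev)) ⊗≫ 𝟙 _ := by
      dsimp only [inducedHom]; monoidal
    _ = 𝟙 _ ⊗≫ p.Q ◁ X ◁ p.coev ▷ p.P ⊗≫
        p.Q ◁ (s ▷ (p.Q ⊗ p.P) ≫ (p.P ⊗ X) ◁ p.ev) ⊗≫ p.ev ▷ X ⊗≫ 𝟙 _ := by
      rw [← whisker_exchange]; monoidal
    _ = 𝟙 _ ⊗≫ p.Q ◁ X ◁ (p.coev ▷ p.P ⊗≫ p.P ◁ p.ev) ⊗≫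
        p.Q ◁ s ⊗≫ p.ev ▷ X ⊗≫ 𝟙 _ := by
      rw [← whisker_exchange]; monoidal
    _ = _ := by rw [p.snake]; monoidal

theorem coev'_inducedInv {X : C} (t : p.P ⊗ X ⟶ X ⊗ p.P) :
    X ◁ p.coev' ⊗≫ inducedInv p t ▷ p.P =
      (ρ_ X).hom ≫ (λ_ X).inv ≫ p.coev' ▷ X ⊗≫ p.Q ◁ t ⊗≫ 𝟙 _ := by
  calc
    _ = 𝟙 _ ⊗≫ (𝟙_ C ◁ (X ◁ p.coev') ≫ p.coev' ▷ (X ⊗ p.Q ⊗ p.P)) ⊗≫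
        p.Q ◁ t ▷ (p.Q ⊗ p.P) ⊗≫ p.Q ◁ X ◁ p.ev' ▷ p.P ⊗≫ 𝟙 _ := by
      dsimp only [inducedInv]; monoidal
    _ = 𝟙 _ ⊗≫ p.coev' ▷ X ⊗≫
        p.Q ◁ ((p.P ⊗ X) ◁ p.coev' ≫ t ▷ (p.Q ⊗ p.P)) ⊗≫ p.Q ◁ X ◁ p.ev' ▷ p.P ⊗≫ 𝟙 _ := by
      rw [whisker_exchange]; monoidal
    _ = 𝟙 _ ⊗≫ p.coev' ▷ X ⊗≫ p.Q ◁ t ⊗≫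
        p.Q ◁ X ◁ (p.P ◁ p.coev' ⊗≫ p.ev' ▷ p.P) ⊗≫ 𝟙 _ := by
      rw [whisker_exchange]; monoidal
    _ = _ := by rw [p.snake']; monoidal

theorem inducedInv_ev' {X : C} (t : p.P ⊗ X ⟶ X ⊗ p.P) :
    p.P ◁ inducedInv p t ⊗≫ p.ev' ▷ X = 𝟙 _ ⊗≫ t ▷ p.Q ⊗≫ X ◁ p.ev' ≫ (ρ_ X).hom ≫ (λ_ X).inv := by
  calc
    _ = 𝟙 _ ⊗≫ p.P ◁ p.coev' ▷ X ▷ p.Q ⊗≫ p.P ◁ p.Q ◁ t ▷ p.Q ⊗≫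
        ((p.P ⊗ p.Q) ◁ (X ◁ p.ev') ≫ p.ev' ▷ (X ⊗ 𝟙_ C)) ⊗≫ 𝟙 _ := by
      dsimp only [inducedInv]; monoidal
    _ = 𝟙 _ ⊗≫ p.P ◁ p.coev' ▷ X ▷ p.Q ⊗≫
        ((p.P ⊗ p.Q) ◁ (t ▷ p.Q) ≫ p.ev' ▷ ((X ⊗ p.P) ⊗ p.Q)) ⊗≫ X ◁ p.ev' ⊗≫ 𝟙 _ := by
      rw [whisker_exchange]; monoidal
    _ = 𝟙 _ ⊗≫ (p.P ◁ p.coev' ⊗≫ p.ev' ▷ p.P) ▷ (X ⊗ p.Q) ⊗≫ t ▷ p.Q ⊗≫ X ◁ p.ev' ⊗≫ 𝟙 _ := by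
      rw [whisker_exchange]; monoidal
    _ = _ := by rw [p.snake']; monoidal

/-- An intertwining inverse for `Q` that is compatible with `ev` is the induced one. -/
theorem eq_inducedHom {X : C} (s : X ⊗ p.P ⟶ p.P ⊗ X) (r : p.Q ⊗ X ⟶ X ⊗ p.Q)
    (h : r ▷ p.P ⊗≫ X ◁ p.ev = 𝟙 _ ⊗≫ p.Q ◁ s ⊗≫ p.ev ▷ X ≫ (λ_ X).hom ≫ (ρ_ X).inv) :
    inducedHom p s = r := by
  calc
    _ = 𝟙 _ ⊗≫ p.Q ◁ X ◁ p.coev ⊗≫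
        (𝟙 ((p.Q ⊗ X) ⊗ p.P) ⊗≫ p.Q ◁ s ⊗≫ p.ev ▷ X ≫ (λ_ X).hom ≫ (ρ_ X).inv) ▷ p.Q ⊗≫ 𝟙 _ := by
      dsimp only [inducedHom]; monoidal
    -- The hypothesis trades `s` for `r`; the remaining zigzag now lies on the `Q`-strand, hence
    -- `snakeQ` rather than `snake`.
    _ = 𝟙 _ ⊗≫ ((p.Q ⊗ X) ◁ p.coev ≫ r ▷ (p.P ⊗ p.Q)) ⊗≫ X ◁ p.ev ▷ p.Q ⊗≫ 𝟙 _ := by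
      rw [← h]; monoidal
    _ = 𝟙 _ ⊗≫ r ⊗≫ X ◁ (p.Q ◁ p.coev ⊗≫ p.ev ▷ p.Q) ⊗≫ 𝟙 _ := by
      rw [whisker_exchange]; monoidal
    _ = _ := by rw [p.snakeQ]; monoidal

/-- An intertwining for `Q` that is compatible with `ev'` is the induced one. -/
theorem eq_inducedInv {X : C} (t : p.P ⊗ X ⟶ X ⊗ p.P) (r : X ⊗ p.Q ⟶ p.Q ⊗ X)
    (h : p.P ◁ r ⊗≫ p.ev' ▷ X = 𝟙 _ ⊗≫ t ▷ p.Q ⊗≫ X ◁ p.ev' ≫ (ρ_ X).hom ≫ (λ_ X).inv) :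
    inducedInv p t = r := by
  calc
    _ = 𝟙 _ ⊗≫ p.coev' ▷ X ▷ p.Q ⊗≫
        p.Q ◁ (𝟙 (p.P ⊗ X ⊗ p.Q) ⊗≫ t ▷ p.Q ⊗≫ X ◁ p.ev' ≫ (ρ_ X).hom ≫ (λ_ X).inv) ⊗≫ 𝟙 _ := by
      dsimp only [inducedInv]; monoidal
    _ = 𝟙 _ ⊗≫ (p.coev' ▷ (X ⊗ p.Q) ≫ (p.Q ⊗ p.P) ◁ r) ⊗≫ p.Q ◁ p.ev' ▷ X ⊗≫ 𝟙 _ := by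
      rw [← h]; monoidal
    _ = 𝟙 _ ⊗≫ r ⊗≫ (p.coev' ▷ p.Q ⊗≫ p.Q ◁ p.ev') ▷ X ⊗≫ 𝟙 _ := by
      rw [← whisker_exchange]; monoidal
    _ = _ := by rw [p.snakeQ']; monoidal

/-! ### Extension of `σ` to all formal tensor products, and its naturality. -/

namespace Intertwined

/-- The invertible intertwining of `X` with `Q` induced by `σ`. -/
def negIso (A : Intertwined p) : A.X ⊗ p.Q ≅ p.Q ⊗ A.X where
  hom := inducedInv p A.σ.inv
  inv := inducedHom p A.σ.hom
  hom_inv_id := A.inv_hom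
  inv_hom_id := A.hom_inv

/-- The extension of `σ` to all formal tensor products of `P` and `Q`. -/
def extend (A : Intertwined p) : ∀ M : Piv, A.X ⊗ ωObj p M ≅ ωObj p M ⊗ A.X
  | .pos => A.σ
  | .neg => A.negIso
  | .unit => ρ_ A.X ≪≫ (λ_ A.X).symm
  | .tensor M N => (α_ _ _ _).symm ≪≫ whiskerRightIso (A.extend M) (ωObj p N) ≪≫ α_ _ _ _ ≪≫
      whiskerLeftIso (ωObj p M) (A.extend N) ≪≫ (α_ _ _ _).symm

theorem extend_unit_hom (A : Intertwined p) :
    (A.extend .unit).hom = (ρ_ A.X).hom ≫ (λ_ A.X).inv := rfl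

theorem extend_tensor_hom (A : Intertwined p) (M N : Piv) :
    (A.extend (M.tensor N)).hom = (α_ A.X (ωObj p M) (ωObj p N)).inv ≫
      (A.extend M).hom ▷ ωObj p N ≫ (α_ (ωObj p M) A.X (ωObj p N)).hom ≫
        ωObj p M ◁ (A.extend N).hom ≫ (α_ (ωObj p M) (ωObj p N) A.X).inv := rfl

/-- Bending turns `coev` followed by `σ` into `coev` followed by `inducedHom`, and the component at
`-` cancels the latter. This uses the condition `hom_inv`; the case of `ev` uses `inv_hom`. -/
theorem extend_coev (A : Intertwined p) :
    A.X ◁ p.coev ≫ (A.extend (.tensor .pos .neg)).hom =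
      (A.extend .unit).hom ≫ p.coev ▷ A.X := by
  rw [extend_unit_hom, extend_tensor_hom]
  dsimp only [ωObj, extend]
  calc
    _ = 𝟙 _ ⊗≫ ((λ_ A.X).hom ≫ (ρ_ A.X).inv ≫ A.X ◁ p.coev ⊗≫ A.σ.hom ▷ p.Q ⊗≫ 𝟙 (p.P ⊗ A.X ⊗ p.Q)) ⊗≫
        p.P ◁ A.negIso.hom ⊗≫ 𝟙 _ := by monoidal
    _ = 𝟙 _ ⊗≫ p.coev ▷ A.X ⊗≫ p.P ◁ (A.negIso.inv ≫ A.negIso.hom) ⊗≫ 𝟙 _ := by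
      rw [← coev_inducedHom]; dsimp only [negIso]; monoidal
    _ = _ := by rw [A.negIso.inv_hom_id]; monoidal

theorem extend_ev (A : Intertwined p) :
    A.X ◁ p.ev ≫ (A.extend .unit).hom =
      (A.extend (.tensor .neg .pos)).hom ≫ p.ev ▷ A.X := by
  rw [extend_unit_hom, extend_tensor_hom]
  dsimp only [ωObj, extend]
  symm
  calc
    _ = 𝟙 _ ⊗≫ A.negIso.hom ▷ p.P ⊗≫
        (𝟙 ((p.Q ⊗ A.X) ⊗ p.P) ⊗≫ p.Q ◁ A.σ.hom ⊗≫ p.ev ▷ A.X ≫ (λ_ A.X).hom ≫ (ρ_ A.X).inv) ⊗≫ 𝟙 _ := by monoidal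
    _ = 𝟙 _ ⊗≫ (A.negIso.hom ≫ A.negIso.inv) ▷ p.P ⊗≫ A.X ◁ p.ev ⊗≫ 𝟙 _ := by
      rw [← inducedHom_ev]; dsimp only [negIso]; monoidal
    _ = _ := by rw [A.negIso.hom_inv_id]; monoidal

/-- Here bending the component at `-` produces the inverse of `σ`, which cancels against `σ` itself,
so the mutual inverse condition plays no role in the computation. The same holds for `ev'`. -/
theorem extend_coev' (A : Intertwined p) :
    A.X ◁ p.coev' ≫ (A.extend (.tensor .neg .pos)).hom =
      (A.extend .unit).hom ≫ p.coev' ▷ A.X := by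
  rw [extend_unit_hom, extend_tensor_hom]
  dsimp only [ωObj, extend]
  calc
    _ = 𝟙 _ ⊗≫ (A.X ◁ p.coev' ⊗≫ inducedInv p A.σ.inv ▷ p.P) ⊗≫ p.Q ◁ A.σ.hom ⊗≫ 𝟙 _ := by
      dsimp only [negIso]; monoidal
    _ = 𝟙 _ ⊗≫ p.coev' ▷ A.X ⊗≫ p.Q ◁ (A.σ.inv ≫ A.σ.hom) ⊗≫ 𝟙 _ := by
      rw [coev'_inducedInv]; monoidal
    _ = _ := by rw [A.σ.inv_hom_id]; monoidal

theorem extend_ev' (A : Intertwined p) :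
    A.X ◁ p.ev' ≫ (A.extend .unit).hom =
      (A.extend (.tensor .pos .neg)).hom ≫ p.ev' ▷ A.X := by
  rw [extend_unit_hom, extend_tensor_hom]
  dsimp only [ωObj, extend]
  symm
  calc
    _ = 𝟙 _ ⊗≫ A.σ.hom ▷ p.Q ⊗≫ (p.P ◁ inducedInv p A.σ.inv ⊗≫ p.ev' ▷ A.X) ⊗≫ 𝟙 _ := by
      dsimp only [negIso]; monoidal
    _ = 𝟙 _ ⊗≫ (A.σ.hom ≫ A.σ.inv) ▷ p.Q ⊗≫ A.X ◁ p.ev' ⊗≫ 𝟙 _ := by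
      rw [inducedInv_ev']; monoidal
    _ = _ := by rw [A.σ.hom_inv_id]; monoidal

/-- The induction runs over formal morphisms, before passing to the quotient: the claim is an
equation in `C` about `ωHom p f`, so the relations of `Piv` need no separate check. -/
theorem extend_naturality (A : Intertwined p) {M N : Piv} (f : Piv.Hom M N) :
    A.X ◁ ωHom p f ≫ (A.extend N).hom = (A.extend M).hom ≫ ωHom p f ▷ A.X := by
  induction f with
  | coev => exact A.extend_coev
  | ev => exact A.extend_ev
  | coev' => exact A.extend_coev'
  | ev' => exact A.extend_ev'
  | id X => simp [ωHom]
  | α_hom X Y Z => simp only [extend_tensor_hom, ωHom, ωObj]; monoidal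
  | α_inv X Y Z => simp only [extend_tensor_hom, ωHom, ωObj]; monoidal
  | l_hom X => simp only [extend_tensor_hom, extend_unit_hom, ωHom, ωObj]; monoidal
  | l_inv X => simp only [extend_tensor_hom, extend_unit_hom, ωHom, ωObj]; monoidal
  | ρ_hom X => simp only [extend_tensor_hom, extend_unit_hom, ωHom, ωObj]; monoidal
  | ρ_inv X => simp only [extend_tensor_hom, extend_unit_hom, ωHom, ωObj]; monoidal
  | comp f g hf hg =>
    simp only [ωHom, MonoidalCategory.whiskerLeft_comp, comp_whiskerRight, Category.assoc]
    rw [hg, reassoc_of% hf]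
  | @whiskerLeft X Y Z f hf =>
    simp only [extend_tensor_hom, ωHom, ωObj]
    calc
      _ = 𝟙 _ ⊗≫ (((A.X ⊗ ωObj p X) ◁ ωHom p f) ≫ (A.extend X).hom ▷ ωObj p Z) ⊗≫
          ωObj p X ◁ (A.extend Z).hom ⊗≫ 𝟙 _ := by monoidal
      _ = 𝟙 _ ⊗≫ (A.extend X).hom ▷ ωObj p Y ⊗≫
          ωObj p X ◁ (A.X ◁ ωHom p f ≫ (A.extend Z).hom) ⊗≫ 𝟙 _ := by
        rw [whisker_exchange]; monoidal
      _ = _ := by rw [hf]; monoidal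
  | @whiskerRight X Y f Z hf =>
    simp only [extend_tensor_hom, ωHom, ωObj]
    calc
      _ = 𝟙 _ ⊗≫ (A.X ◁ ωHom p f ≫ (A.extend Y).hom) ▷ ωObj p Z ⊗≫
          ωObj p Y ◁ (A.extend Z).hom ⊗≫ 𝟙 _ := by monoidal
      _ = 𝟙 _ ⊗≫ (A.extend X).hom ▷ ωObj p Z ⊗≫
          (ωHom p f ▷ (A.X ⊗ ωObj p Z) ≫ ωObj p Y ◁ (A.extend Z).hom) ⊗≫ 𝟙 _ := by
        rw [hf]; monoidal
      _ = _ := by rw [← whisker_exchange]; monoidal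

end Intertwined

/-! ### Morphisms and objects passing to the dual. -/

theorem inducedInv_naturality {X Y : C} {s : p.P ⊗ X ⟶ X ⊗ p.P} {t : p.P ⊗ Y ⟶ Y ⊗ p.P}
    (f : X ⟶ Y) (h : p.P ◁ f ≫ t = s ≫ f ▷ p.P) :
    f ▷ p.Q ≫ inducedInv p t = inducedInv p s ≫ p.Q ◁ f := by
  calc
    _ = 𝟙 _ ⊗≫ (𝟙_ C ◁ (f ▷ p.Q) ≫ p.coev' ▷ (Y ⊗ p.Q)) ⊗≫ p.Q ◁ t ▷ p.Q ⊗≫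
        p.Q ◁ Y ◁ p.ev' ⊗≫ 𝟙 _ := by
      dsimp only [inducedInv]; monoidal
    _ = 𝟙 _ ⊗≫ p.coev' ▷ X ▷ p.Q ⊗≫ p.Q ◁ (p.P ◁ f ≫ t) ▷ p.Q ⊗≫
        p.Q ◁ Y ◁ p.ev' ⊗≫ 𝟙 _ := by
      rw [whisker_exchange]; monoidal
    _ = 𝟙 _ ⊗≫ p.coev' ▷ X ▷ p.Q ⊗≫ p.Q ◁ s ▷ p.Q ⊗≫
        p.Q ◁ (f ▷ (p.P ⊗ p.Q) ≫ Y ◁ p.ev') ⊗≫ 𝟙 _ := by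
      rw [h]; monoidal
    _ = _ := by
      rw [← whisker_exchange]; dsimp only [inducedInv]; monoidal

namespace Intertwined

/-- Compatibility with `σ` passes to the inverse of `σ`, hence to its mate at `-`, and then through
the tensor recursion. -/
theorem extend_comm {A B : Intertwined p} (f : A ⟶ B) (M : Piv) :
    f.f ▷ ωObj p M ≫ (B.extend M).hom = (A.extend M).hom ≫ ωObj p M ◁ f.f := by
  induction M with
  | pos => exact f.comm
  | neg =>
    refine inducedInv_naturality f.f ?_
    rw [← cancel_epi A.σ.hom, ← reassoc_of% f.comm, B.σ.hom_inv_id, Category.comp_id,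
      A.σ.hom_inv_id_assoc]
  | unit => rw [extend_unit_hom, extend_unit_hom]; simp only [ωObj]; monoidal
  | tensor M N hM hN =>
    simp only [extend_tensor_hom, ωObj]
    calc
      _ = 𝟙 _ ⊗≫ (f.f ▷ ωObj p M ≫ (B.extend M).hom) ▷ ωObj p N ⊗≫
          ωObj p M ◁ (B.extend N).hom ⊗≫ 𝟙 _ := by monoidal
      _ = 𝟙 _ ⊗≫ (A.extend M).hom ▷ ωObj p N ⊗≫
          ωObj p M ◁ (f.f ▷ ωObj p N ≫ (B.extend N).hom) ⊗≫ 𝟙 _ := by rw [hM]; monoidal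
      _ = _ := by rw [hN]; monoidal

/-- The object of the dual of `ω` determined by an intertwined object. -/
def toDual (A : Intertwined p) : Dual (ω p) where
  X := A.X
  τ M := A.extend M
  naturality := by rintro M N ⟨f⟩; exact A.extend_naturality f
  tensor M N := by
    -- The structure morphisms of `ω` are identities, so the axiom becomes the defining recursion of
    -- `extend`.
    change _ = A.X ◁ 𝟙 (ωObj p M ⊗ ωObj p N) ≫ (A.extend (M.tensor N)).hom ≫
      𝟙 (ωObj p M ⊗ ωObj p N) ▷ A.X
    rw [MonoidalCategory.whiskerLeft_id, id_whiskerRight, Category.id_comp]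
    exact (Category.comp_id _).symm
  unit := by
    change A.X ◁ 𝟙 (𝟙_ C) ≫ ((ρ_ A.X).hom ≫ (λ_ A.X).inv) ≫ 𝟙 (𝟙_ C) ▷ A.X = _
    simp

end Intertwined

/-! ### Recovering `τ` from its component at `+`. -/

namespace Dual

theorem τ_tensor_hom (A : Dual (ω p)) (M N : Piv) :
    (A.τ (M.tensor N)).hom = (α_ A.X (ωObj p M) (ωObj p N)).inv ≫
      (A.τ M).hom ▷ ωObj p N ≫ (α_ (ωObj p M) A.X (ωObj p N)).hom ≫
        ωObj p M ◁ (A.τ N).hom ≫ (α_ (ωObj p M) (ωObj p N) A.X).inv := by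
  refine Eq.trans ?_ (A.tensor M N).symm
  change _ = A.X ◁ 𝟙 (ωObj p M ⊗ ωObj p N) ≫ (A.τ (M.tensor N)).hom ≫
    𝟙 (ωObj p M ⊗ ωObj p N) ▷ A.X
  rw [MonoidalCategory.whiskerLeft_id, id_whiskerRight, Category.id_comp]
  exact (Category.comp_id _).symm

theorem τ_unit_hom (A : Dual (ω p)) :
    (A.τ .unit).hom = (ρ_ A.X).hom ≫ (λ_ A.X).inv := by
  refine Eq.trans ?_ A.unit
  change _ = A.X ◁ 𝟙 (𝟙_ C) ≫ (A.τ .unit).hom ≫ 𝟙 (𝟙_ C) ▷ A.X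
  rw [MonoidalCategory.whiskerLeft_id, id_whiskerRight, Category.id_comp]
  exact (Category.comp_id _).symm

/-- The component of `τ` at `+`. -/
def posIso (A : Dual (ω p)) : A.X ⊗ p.P ≅ p.P ⊗ A.X := A.τ .pos

/-- The component of `τ` at `-`. -/
def negIso (A : Dual (ω p)) : A.X ⊗ p.Q ≅ p.Q ⊗ A.X := A.τ .neg

theorem ev_comm (A : Dual (ω p)) :
    A.X ◁ p.ev ≫ (ρ_ A.X).hom ≫ (λ_ A.X).inv =
      ((α_ A.X p.Q p.P).inv ≫ A.negIso.hom ▷ p.P ≫ (α_ p.Q A.X p.P).hom ≫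
        p.Q ◁ A.posIso.hom ≫ (α_ p.Q p.P A.X).inv) ≫ p.ev ▷ A.X := by
  rw [← A.τ_unit_hom]
  refine (A.naturality (Piv.mk Piv.Hom.ev)).trans ?_
  exact congr_arg (· ≫ p.ev ▷ A.X) (A.τ_tensor_hom .neg .pos)

theorem ev'_comm (A : Dual (ω p)) :
    A.X ◁ p.ev' ≫ (ρ_ A.X).hom ≫ (λ_ A.X).inv =
      ((α_ A.X p.P p.Q).inv ≫ A.posIso.hom ▷ p.Q ≫ (α_ p.P A.X p.Q).hom ≫
        p.P ◁ A.negIso.hom ≫ (α_ p.P p.Q A.X).inv) ≫ p.ev' ▷ A.X := by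
  rw [← A.τ_unit_hom]
  refine (A.naturality (Piv.mk Piv.Hom.ev')).trans ?_
  exact congr_arg (· ≫ p.ev' ▷ A.X) (A.τ_tensor_hom .pos .neg)

/-- By naturality at `ev`, the inverse of the component at `-` satisfies the equation that
characterizes the mate. The companion below uses `ev'`; together they give the mutual inverse
condition. -/
theorem inducedHom_posIso (A : Dual (ω p)) :
    inducedHom p A.posIso.hom = A.negIso.inv := by
  apply eq_inducedHom
  calc
    _ = 𝟙 _ ⊗≫ A.negIso.inv ▷ p.P ⊗≫ (A.X ◁ p.ev ≫ (ρ_ A.X).hom ≫ (λ_ A.X).inv) ⊗≫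
        𝟙 (A.X ⊗ 𝟙_ C) := by monoidal
    _ = 𝟙 _ ⊗≫ (A.negIso.inv ≫ A.negIso.hom) ▷ p.P ⊗≫ p.Q ◁ A.posIso.hom ⊗≫ p.ev ▷ A.X ⊗≫ 𝟙 _ := by
      rw [ev_comm]; monoidal
    _ = _ := by rw [A.negIso.inv_hom_id]; monoidal

theorem inducedInv_posIso (A : Dual (ω p)) :
    inducedInv p A.posIso.inv = A.negIso.hom := by
  apply eq_inducedInv
  symm
  calc
    _ = 𝟙 _ ⊗≫ A.posIso.inv ▷ p.Q ⊗≫ (A.X ◁ p.ev' ≫ (ρ_ A.X).hom ≫ (λ_ A.X).inv) := by monoidal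
    _ = 𝟙 _ ⊗≫ (A.posIso.inv ≫ A.posIso.hom) ▷ p.Q ⊗≫ p.P ◁ A.negIso.hom ⊗≫ p.ev' ▷ A.X := by
      rw [ev'_comm]; monoidal
    _ = _ := by rw [A.posIso.inv_hom_id]; monoidal

/-- The intertwined object obtained by evaluating `τ` at `+`. -/
def toIntertwined (A : Dual (ω p)) : Intertwined p where
  X := A.X
  σ := A.posIso
  hom_inv := by rw [inducedHom_posIso, inducedInv_posIso, Iso.inv_hom_id]
  inv_hom := by rw [inducedHom_posIso, inducedInv_posIso, Iso.hom_inv_id]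

theorem extend_toIntertwined (A : Dual (ω p)) (M : Piv) :
    A.toIntertwined.extend M = A.τ M := by
  apply Iso.ext
  induction M with
  | pos => rfl
  | neg => exact A.inducedInv_posIso
  | unit => exact A.τ_unit_hom.symm
  | tensor M N hM hN =>
    rw [Intertwined.extend_tensor_hom, τ_tensor_hom, hM, hN]; rfl

theorem toDual_toIntertwined (A : Dual (ω p)) : A.toIntertwined.toDual = A :=
  -- The underlying object is unchanged definitionally, so the heterogeneous equality of the
  -- families `τ` is an ordinary one.
  Dual.ext rfl (heq_of_eq (funext A.extend_toIntertwined))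

/-- Makes transports harmless: when two objects share their underlying object definitionally,
`eqToHom` between them has an identity underneath. -/
theorem eqToHom_f {D : Type u₁} [Category.{v₁} D] [MonoidalCategory D] {U : D ⥤ C} [U.Monoidal]
    {A B : Dual U} (h : A = B) : Hom.f (eqToHom h) = eqToHom (congr_arg Dual.X h) := by
  subst h; rfl

end Dual

/-! ### The two strict monoidal functors. -/

/-- Evaluating the left side at `+` gives `A ⊗ B` definitionally, so the round trip
`toDual_toIntertwined` already is this equation and no induction over `Piv` is needed. The unit is
handled likewise. -/
theorem Intertwined.toDual_tensor (A B : Intertwined p) :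
    A.toDual ⊗ B.toDual = (A ⊗ B).toDual :=
  (A.toDual ⊗ B.toDual).toDual_toIntertwined.symm

theorem Intertwined.toDual_unit : 𝟙_ (Dual (ω p)) = (𝟙_ (Intertwined p)).toDual :=
  (𝟙_ (Dual (ω p))).toDual_toIntertwined.symm

variable (p)

/-- The functor `(X, σ) ↦ (X, τ)` extending `σ` to all of `Piv`. -/
def extendFunctor : Intertwined p ⥤ Dual (ω p) where
  obj A := A.toDual
  map f := ⟨f.f, Intertwined.extend_comm f⟩

/-- The functor `(X, τ) ↦ (X, τ₊)`. -/
def evalFunctor : Dual (ω p) ⥤ Intertwined p where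
  obj A := A.toIntertwined
  map f := ⟨f.f, f.comm .pos⟩

instance : (extendFunctor p).Monoidal :=
  Functor.CoreMonoidal.toMonoidal
    { εIso := eqToIso Intertwined.toDual_unit
      μIso := fun A B => eqToIso (Intertwined.toDual_tensor A B)
      μIso_hom_natural_left := fun {A B} f E => by
        apply Dual.Hom.ext
        change f.f ▷ E.X ≫ Dual.Hom.f (eqToHom (Intertwined.toDual_tensor B E)) =
          Dual.Hom.f (eqToHom (Intertwined.toDual_tensor A E)) ≫ f.f ▷ E.X
        rw [Dual.eqToHom_f, Dual.eqToHom_f]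
        exact (Category.comp_id _).trans (Category.id_comp _).symm
      μIso_hom_natural_right := fun {A B} E f => by
        apply Dual.Hom.ext
        change E.X ◁ f.f ≫ Dual.Hom.f (eqToHom (Intertwined.toDual_tensor E B)) =
          Dual.Hom.f (eqToHom (Intertwined.toDual_tensor E A)) ≫ E.X ◁ f.f
        rw [Dual.eqToHom_f, Dual.eqToHom_f]
        exact (Category.comp_id _).trans (Category.id_comp _).symm
      associativity := fun A B E => by
        apply Dual.Hom.ext
        change Dual.Hom.f (eqToHom (Intertwined.toDual_tensor A B)) ▷ E.X ≫
            Dual.Hom.f (eqToHom (Intertwined.toDual_tensor (A ⊗ B) E)) ≫ (α_ A.X B.X E.X).hom =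
          (α_ A.X B.X E.X).hom ≫ A.X ◁ Dual.Hom.f (eqToHom (Intertwined.toDual_tensor B E)) ≫
            Dual.Hom.f (eqToHom (Intertwined.toDual_tensor A (B ⊗ E)))
        simp only [Dual.eqToHom_f]
        change 𝟙 (A.X ⊗ B.X) ▷ E.X ≫ 𝟙 _ ≫ (α_ A.X B.X E.X).hom =
          (α_ A.X B.X E.X).hom ≫ A.X ◁ 𝟙 (B.X ⊗ E.X) ≫ 𝟙 _
        simp
      left_unitality := fun A => by
        apply Dual.Hom.ext
        change (λ_ A.X).hom = Dual.Hom.f (eqToHom Intertwined.toDual_unit) ▷ A.X ≫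
          Dual.Hom.f (eqToHom (Intertwined.toDual_tensor (𝟙_ _) A)) ≫ (λ_ A.X).hom
        simp only [Dual.eqToHom_f]
        change (λ_ A.X).hom = 𝟙 (𝟙_ C) ▷ A.X ≫ 𝟙 _ ≫ (λ_ A.X).hom
        simp
      right_unitality := fun A => by
        apply Dual.Hom.ext
        change (ρ_ A.X).hom = A.X ◁ Dual.Hom.f (eqToHom Intertwined.toDual_unit) ≫
          Dual.Hom.f (eqToHom (Intertwined.toDual_tensor A (𝟙_ _))) ≫ (ρ_ A.X).hom
        simp only [Dual.eqToHom_f]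
        change (ρ_ A.X).hom = A.X ◁ 𝟙 (𝟙_ C) ≫ 𝟙 _ ≫ (ρ_ A.X).hom
        simp }

theorem extendFunctor_isStrictMonoidal : IsStrictMonoidal (extendFunctor p) where
  obj_tensor := Intertwined.toDual_tensor
  obj_unit := Intertwined.toDual_unit
  μ_eq _ _ := rfl
  ε_eq := rfl

instance : (evalFunctor p).Monoidal :=
  Functor.CoreMonoidal.toMonoidal
    { εIso := Iso.refl (𝟙_ (Intertwined p))
      μIso := fun A B => Iso.refl (A.toIntertwined ⊗ B.toIntertwined)
      μIso_hom_natural_left := fun _ _ => (Category.comp_id _).trans (Category.id_comp _).symm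
      μIso_hom_natural_right := fun _ _ => (Category.comp_id _).trans (Category.id_comp _).symm
      associativity := fun A B E => by
        apply Intertwined.Hom.ext
        change 𝟙 (A.X ⊗ B.X) ▷ E.X ≫ 𝟙 _ ≫ (α_ A.X B.X E.X).hom =
          (α_ A.X B.X E.X).hom ≫ A.X ◁ 𝟙 (B.X ⊗ E.X) ≫ 𝟙 _
        simp
      left_unitality := fun A => by
        apply Intertwined.Hom.ext
        change (λ_ A.X).hom = 𝟙 (𝟙_ C) ▷ A.X ≫ 𝟙 _ ≫ (λ_ A.X).hom
        simp
      right_unitality := fun A => by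
        apply Intertwined.Hom.ext
        change (ρ_ A.X).hom = A.X ◁ 𝟙 (𝟙_ C) ≫ 𝟙 _ ≫ (ρ_ A.X).hom
        simp }

theorem evalFunctor_isStrictMonoidal : IsStrictMonoidal (evalFunctor p) where
  obj_tensor _ _ := rfl
  obj_unit := rfl
  μ_eq _ _ := rfl
  ε_eq := rfl

theorem evalFunctor_comp_extendFunctor : evalFunctor p ⋙ extendFunctor p = 𝟭 (Dual (ω p)) :=
  CategoryTheory.Functor.ext (fun A => A.toDual_toIntertwined) (fun A B f => by
    apply Dual.Hom.ext
    change f.f = Dual.Hom.f (eqToHom A.toDual_toIntertwined) ≫ f.f ≫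
      Dual.Hom.f (eqToHom B.toDual_toIntertwined.symm)
    rw [Dual.eqToHom_f, Dual.eqToHom_f]
    exact ((Category.id_comp _).trans (Category.comp_id _)).symm)

end

end PivotalDual

theorem mainTheorem8 {C : Type u} [Category.{v} C] [MonoidalCategory C]
    (p : PivotalDual.PivotalPair C) :
    ∃ (F : PivotalDual.Intertwined p ⥤ PivotalDual.Dual (PivotalDual.ω p))
      (G : PivotalDual.Dual (PivotalDual.ω p) ⥤ PivotalDual.Intertwined p)
      (_ : F.Monoidal) (_ : G.Monoidal),
      PivotalDual.IsStrictMonoidal F ∧ PivotalDual.IsStrictMonoidal G ∧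
      F ⋙ G = 𝟭 (PivotalDual.Intertwined p) ∧
      G ⋙ F = 𝟭 (PivotalDual.Dual (PivotalDual.ω p)) ∧
      F ⋙ PivotalDual.Dual.forget (PivotalDual.ω p) = PivotalDual.Intertwined.forget p ∧
      G ⋙ PivotalDual.Intertwined.forget p = PivotalDual.Dual.forget (PivotalDual.ω p) :=
  ⟨PivotalDual.extendFunctor p, PivotalDual.evalFunctor p, inferInstance, inferInstance,
    PivotalDual.extendFunctor_isStrictMonoidal p, PivotalDual.evalFunctor_isStrictMonoidal p,
    -- Extending and then evaluating at `+` returns `σ` by definition; only the other composite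
    -- needs the reconstruction of `τ`.
    rfl, PivotalDual.evalFunctor_comp_extendFunctor p, rfl, rfl⟩
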